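/- **Corollary (finite function classes with completeness).** *Game.* Consider an episodic two-player zero-sum Markov game with horizon $H$, state space $\mathcal X$ (possibly infinite), action spaces $\mathcal A,\mathcal B$ of the max- and the min-player, transition kernels $\mathbb P_h(\cdot\mid x,a,b)$, deterministic rewards $r^h(x,a,b)\in[0,1]$ and a fixed initial state $x^1$. For Markov policies $\mu=(\mu_h)_h,\nu=(\nu_h)_h$ let $V_h^{\mu,\nu},Q_h^{\mu,\nu}$ be the usual value functions ($V_{H+1}^{\mu,\nu}=0$), and put $V_h^{\mu,\dagger}=\inf_\nu V_h^{\mu,\nu}$, $Q_h^{\mu,\dagger}=\inf_\nu Q_h^{\mu,\nu}$. Let $(\mu^*,\nu^*)$ be a Nash equilibrium, i.e. $V_h^{\mu,\nu^*}(x)\le V_h^{\mu^*,\nu^*}(x)\le V_h^{\mu^*,\nu}(x)$ for all $\mu,\nu,h,x$, and put $V^*=V^{\mu^*,\nu^*}$, $Q^*=Q^{\mu^*,\nu^*}$. *Function class.* Let $\mathcal F=\mathcal F_1\times\dots\times\mathcal F_H$ with finite sets $\mathcal F_h$ of functions $\mathcal X\times\mathcal A\times\mathcal B\to\mathbb R$,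 so $|\mathcal F|=\prod_h|\mathcal F_h|$. For $f\in\mathcal F$ put $f^{H+1}=0$ and $$V_{f,h}(x)=\max_{p}\min_{q}\,p^\top f^h(x,\cdot,\cdot)q,\qquad \mu_{f,h}(x)\in\operatorname*{argmax}_{p}\min_{q}\,p^\top f^h(x,\cdot,\cdot)q,$$ where $p,q$ range over the probability distributions on $\mathcal A$ and $\mathcal B$. For a policy $\mu$ put $V^\mu_{f,h}(x)=\min_q\mu_h(x)^\top f^h(x,\cdot,\cdot)q$, and for $f,g\in\mathcal F$ let $\nu_{f,g,h}(x)\in\operatorname*{argmin}_q\mu_{f,h}(x)^\top g^h(x,\cdot,\cdot)q$. (Ties are broken by a fixed rule, such that $\mu_{f,h}$ depends only on $h$ and $f^h$, and $\nu_{f,g,h}$ only on $h,f^h,g^h$.) Put $\mathcal T_h^\mu f(x,a,b)=r^h(x,a,b)+\mathbb E_{x'\sim\mathbb P_h(\cdot\mid x,a,b)}V^\mu_{f,h+1}(x')$ and $\mathcal E_h^\mu(f;x,a,b)=f^h(x,a,b)-\mathcal T_h^\mu f(x,a,b)$. Assume 1. (realizability) $Q_h^*\in\mathcal F_h$ and $Q_h^{\mu_f,\dagger}\in\mathcal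 F_h$ for all $f\in\mathcal F$, $h\in[H]$; 2. (completeness) $\mathcal T_h^{\mu_f}g\in\mathcal F_h$ for all $f,g\in\mathcal F$, $h\in[H]$; 3. (boundedness with $\beta=2$) every function in every $\mathcal F_h$ takes values in $[0,1]$. *Decoupling coefficient.* For $m>0$ let $dc(\mathcal F,MG,T,m)$ be the smallest integer $K\ge 0$ such that for all sequences $f_1,\dots,f_T$ and $g_1,\dots,g_T$ in $\mathcal F$, with $\pi_t=(\mu_{f_t},\nu_{f_t,g_t})$, and for both choices $(e_t)_t=(f_t)_t$ and $(e_t)_t=(g_t)_t$, $$\Bigl|\sum_{h=1}^H\sum_{t=1}^T\mathbb E_{\pi_t}\mathcal E_h^{\mu_{f_t}}(e_t;x^h,a^h,b^h)\Bigr|\le m\sum_{h=1}^H\sum_{t=1}^T\sum_{s=1}^{t-1}\mathbb E_{\pi_s}\bigl[\mathcal E_h^{\mu_{f_t}}(e_t;x^h,a^h,b^h)^2\bigr]+\frac{K}{4m}.$$ Let $dc(\mathcal F,MG,T)>0$ be any upper bound of $\sup_{0<m\le1}dc(\mathcal F,MG,T,m)$. *Algorithm (conditional posterior sampling with booster, uniform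 priors $p_0^h(\varphi)=1/|\mathcal F_h|$).* Let $S_{t-1}$ consist of the trajectories of episodes $1,\dots,t-1$. In episode $t$, draw $f_t\sim p(\cdot\mid S_{t-1})$, then $g_t\sim p^{\mu_{f_t}}(\cdot\mid S_{t-1})$, and execute $(\mu_t,\nu_t)=(\mu_{f_t},\nu_{f_t,g_t})$. Here $$p(f\mid S)\propto e^{\lambda V_{f,1}(x^1)}\prod_{h=1}^H\frac{p_0^h(f^h)e^{-\eta L^h(f^h,f^{h+1};S)}}{\mathbb E_{\varphi\sim p_0^h}e^{-\eta L^h(\varphi,f^{h+1};S)}},\qquad p^\mu(g\mid S)\propto e^{-\lambda V^\mu_{g,1}(x^1)}\prod_{h=1}^H\frac{p_0^h(g^h)e^{-\eta L^h_\mu(g^h,g^{h+1};S)}}{\mathbb E_{\varphi\sim p_0^h}e^{-\eta L^h_\mu(\varphi,g^{h+1};S)}},$$ $L^h(\varphi,f^{h+1};S)=\sum_s[\varphi(x_s^h,a_s^h,b_s^h)-r_s^h-V_{f,h+1}(x_s^{h+1})]^2$, and $L_\mu^h(\varphi,g^{h+1};S)$ is the same with $V^\mu_{g,h+1}$ in place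 of $V_{f,h+1}$; the sums are over the episodes $s$ in $S$. *Conclusion.* There is an absolute constant $C$ such that, for every such game, class and $T$, with $\eta=0.1$ and $\lambda=\sqrt{T\ln|\mathcal F|/dc(\mathcal F,MG,T)}$, $$\mathbb E\sum_{t=1}^T\bigl[V_1^*(x^1)-V_1^{\mu_t,\dagger}(x^1)\bigr]\le C\sqrt{dc(\mathcal F,MG,T)\,T\,\ln|\mathcal F|}.$$ -/

import Mathlib

open MeasureTheory ProbabilityTheory

namespace ZeroSumMG

/-- An episodic two-player zero-sum Markov game with deterministic rewards in `[0, 1]` and a fixed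
initial state. The steps `1, …, H` are numbered `0, …, H - 1`; data at indices `h ≥ H` are never
used. -/
structure MarkovGame (X A B : Type*) [MeasurableSpace X] [MeasurableSpace A]
    [MeasurableSpace B] where
  /-- length of an episode -/
  H : ℕ
  /-- transition kernels -/
  P : ℕ → Kernel (X × A × B) X
  isMarkov_P : ∀ h, IsMarkovKernel (P h)
  /-- rewards -/
  r : ℕ → X × A × B → ℝ
  measurable_r : ∀ h, Measurable (r h)
  r_nonneg : ∀ h s, 0 ≤ r h s
  r_le_one : ∀ h s, r h s ≤ 1
  /-- initial state -/
  x₁ : X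

/-- Markov (probability) kernels. -/
abbrev MKernel (X A : Type*) [MeasurableSpace X] [MeasurableSpace A] :=
  {κ : Kernel X A // IsMarkovKernel κ}

/-- Markov policies: a (measurable) map from states to distributions over actions, for each
step. -/
abbrev Policy (X A : Type*) [MeasurableSpace X] [MeasurableSpace A] := ℕ → MKernel X A

section Game

variable {X A B : Type*} [MeasurableSpace X] [MeasurableSpace A] [MeasurableSpace B]

/-! ### Trajectories and value functions -/

/-- The law of `n` consecutive steps `(x^h, a^h, b^h), …, (x^{h+n-1}, a^{h+n-1}, b^{h+n-1})`
under the policy pair `(μ, ν)`, started at step `h` in the state `x^h = x`. -/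
noncomputable def traj (M : MarkovGame X A B) (μ : Policy X A) (ν : Policy X B) :
    (n h : ℕ) → Kernel X (Fin n → X × A × B)
  | 0, _ => Kernel.deterministic (fun _ => Fin.elim0) measurable_const
  | n + 1, h =>
      ((Kernel.id ×ₖ (traj M μ ν n (h + 1) ∘ₖ M.P h)) ∘ₖ
        (Kernel.id ×ₖ ((μ h).1 ×ₖ (ν h).1))).map
          (fun p : (X × A × B) × (Fin n → X × A × B) =>
            (Fin.cons p.1 p.2 : Fin (n + 1) → X × A × B))

/-- The trajectories of one episode. -/
abbrev Trajectory (M : MarkovGame X A B) := Fin M.H → X × A × B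

/-- The law of the trajectory of an episode in which `(μ, ν)` is executed. -/
noncomputable def episodeLaw (M : MarkovGame X A B) (μ : Policy X A) (ν : Policy X B) :
    Measure (Trajectory M) :=
  traj M μ ν M.H 0 M.x₁

/-- `V_h^{μ,ν}(x)`: expected reward collected from step `h` on, given `x^h = x`. -/
noncomputable def value (M : MarkovGame X A B) (μ : Policy X A) (ν : Policy X B) (h : ℕ)
    (x : X) : ℝ :=
  ∫ ζ, ∑ i : Fin (M.H - h), M.r (h + i) (ζ i) ∂(traj M μ ν (M.H - h) h x)

/-- `Q_h^{μ,ν}(x, a, b)`, for steps `h < H`. -/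
noncomputable def qValue (M : MarkovGame X A B) (μ : Policy X A) (ν : Policy X B) (h : ℕ)
    (s : X × A × B) : ℝ :=
  M.r h s + ∫ x', value M μ ν (h + 1) x' ∂(M.P h s)

/-- `V_h^{μ,†}(x) = inf_ν V_h^{μ,ν}(x)`. -/
noncomputable def brValue (M : MarkovGame X A B) (μ : Policy X A) (h : ℕ) (x : X) : ℝ :=
  ⨅ ν : Policy X B, value M μ ν h x

/-- `Q_h^{μ,†}(x, a, b) = inf_ν Q_h^{μ,ν}(x, a, b)`. -/
noncomputable def brQValue (M : MarkovGame X A B) (μ : Policy X A) (h : ℕ) (s : X × A × B) : ℝ :=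
  ⨅ ν : Policy X B, qValue M μ ν h s

/-- `(μ, ν)` is a Nash equilibrium: at every step and state, neither player can gain by
deviating. -/
def IsNash (M : MarkovGame X A B) (μ : Policy X A) (ν : Policy X B) : Prop :=
  ∀ h < M.H, ∀ x,
    (∀ μ' : Policy X A, value M μ' ν h x ≤ value M μ ν h x) ∧
    (∀ ν' : Policy X B, value M μ ν h x ≤ value M μ ν' h x)

/-! ### Matrix games -/

/-- `p^⊤ G q`. -/
noncomputable def payoff (G : A → B → ℝ) (p : Measure A) (q : Measure B) : ℝ :=
  ∫ a, ∫ b, G a b ∂q ∂p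

/-- `min_q p^⊤ G q`. -/
noncomputable def minPayoff (G : A → B → ℝ) (p : Measure A) : ℝ :=
  ⨅ q : ProbabilityMeasure B, payoff G p q

/-- `max_p min_q p^⊤ G q`. -/
noncomputable def gameValue (G : A → B → ℝ) : ℝ :=
  ⨆ p : ProbabilityMeasure A, minPayoff G p

/-- `p ∈ argmax_{p'} min_q p'^⊤ G q`. -/
def IsMaximin (G : A → B → ℝ) (p : Measure A) : Prop :=
  ∀ p' : ProbabilityMeasure A, minPayoff G (p' : Measure A) ≤ minPayoff G p

/-- `q ∈ argmin_{q'} p^⊤ G q'`. -/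
def IsBestReply (G : A → B → ℝ) (p : Measure A) (q : Measure B) : Prop :=
  ∀ q' : ProbabilityMeasure B, payoff G p q ≤ payoff G p q'

/-! ### Function classes, induced policies, Bellman operators -/

/-- A finite function class `F = F_1 × ⋯ × F_H`, given by its factors. -/
abbrev FunClass (M : MarkovGame X A B) := Fin M.H → Finset (X × A × B → ℝ)

/-- The elements `f = (f^1, …, f^H)` of `F`. -/
def Mem {M : MarkovGame X A B} (F : FunClass M) := (h : Fin M.H) → {φ // φ ∈ F h}

instance {M : MarkovGame X A B} (F : FunClass M) : Fintype (Mem F) :=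
  inferInstanceAs (Fintype ((h : Fin M.H) → {φ // φ ∈ F h}))

instance {M : MarkovGame X A B} (F : FunClass M) : MeasurableSpace (Mem F) := ⊤

/-- The component `f^h`, which is `0` past the last step. -/
def Mem.comp {M : MarkovGame X A B} {F : FunClass M} (f : Mem F) (h : ℕ) : X × A × B → ℝ :=
  if hh : h < M.H then (f ⟨h, hh⟩).1 else 0

/-- `V_{f,h}(x) = max_μ min_ν μ^⊤ f^h(x,·,·) ν`. -/
noncomputable def inducedValue {M : MarkovGame X A B} {F : FunClass M} (f : Mem F) (h : ℕ)
    (x : X) : ℝ :=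
  gameValue fun a b => f.comp h (x, a, b)

/-- `V_{f,h}^μ(x) = min_ν μ_h(x)^⊤ f^h(x,·,·) ν`. -/
noncomputable def inducedBrValue {M : MarkovGame X A B} {F : FunClass M} (μ : Policy X A)
    (f : Mem F) (h : ℕ) (x : X) : ℝ :=
  minPayoff (fun a b => f.comp h (x, a, b)) ((μ h).1 x)

/-- `(𝒯_h^μ f)(x, a, b)`. -/
noncomputable def bellman {M : MarkovGame X A B} {F : FunClass M} (μ : Policy X A) (f : Mem F)
    (h : ℕ) (s : X × A × B) : ℝ :=
  M.r h s + ∫ x', inducedBrValue μ f (h + 1) x' ∂(M.P h s)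

/-- The Bellman residual `ℰ_h^μ(f; x, a, b)`. -/
noncomputable def residual {M : MarkovGame X A B} {F : FunClass M} (μ : Policy X A) (f : Mem F)
    (h : ℕ) (s : X × A × B) : ℝ :=
  f.comp h s - bellman μ f h s

/-- A rule that resolves the `argmax` and the `argmin` in the definition of the policies induced
by functions: `max h (f^h)` is `μ_{f,h}` and `min h (f^h) (g^h)` is `ν_{f,g,h}`. -/
structure Selector (X A B : Type*) [MeasurableSpace X] [MeasurableSpace A]
    [MeasurableSpace B] where
  max : ℕ → (X × A × B → ℝ) → MKernel X A
  min : ℕ → (X × A × B → ℝ) → (X × A × B → ℝ) → MKernel X B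

/-- The selected strategies are an `argmax` resp. an `argmin`. -/
structure Selector.IsOptimal (σ : Selector X A B) {M : MarkovGame X A B} (F : FunClass M) :
    Prop where
  max_isMaximin : ∀ h : Fin M.H, ∀ φ ∈ F h, ∀ x,
    IsMaximin (fun a b => φ (x, a, b)) ((σ.max h φ).1 x)
  min_isBestReply : ∀ h : Fin M.H, ∀ φ ∈ F h, ∀ ψ ∈ F h, ∀ x,
    IsBestReply (fun a b => ψ (x, a, b)) ((σ.max h φ).1 x) ((σ.min h φ ψ).1 x)

/-- `μ_f`. -/
def Selector.maxPolicy (σ : Selector X A B) {M : MarkovGame X A B} {F : FunClass M}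
    (f : Mem F) : Policy X A :=
  fun h => σ.max h (f.comp h)

/-- `ν_{f,g}`. -/
def Selector.minPolicy (σ : Selector X A B) {M : MarkovGame X A B} {F : FunClass M}
    (f g : Mem F) : Policy X B :=
  fun h => σ.min h (f.comp h) (g.comp h)

/-! ### Assumptions on the function class -/

/-- `Q_h^* ∈ F_h`, and `Q_h^{μ_f,†} ∈ F_h` for all `f ∈ F`, where `Q^* = Q^{μ^*,ν^*}`. -/
def Realizable {M : MarkovGame X A B} (F : FunClass M) (σ : Selector X A B)
    (μs : Policy X A) (νs : Policy X B) : Prop :=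
  ∀ h : Fin M.H, qValue M μs νs h ∈ F h ∧ ∀ f : Mem F, brQValue M (σ.maxPolicy f) h ∈ F h

/-- `𝒯_h^{μ_f} g ∈ F_h` for all `f, g ∈ F`. -/
def Complete {M : MarkovGame X A B} (F : FunClass M) (σ : Selector X A B) : Prop :=
  ∀ f g : Mem F, ∀ h : Fin M.H, bellman (σ.maxPolicy f) g h ∈ F h

/-- All functions take values in `[0, β - 1]`. -/
def BoundedBy {M : MarkovGame X A B} (F : FunClass M) (β : ℝ) : Prop :=
  ∀ h : Fin M.H, ∀ φ ∈ F h, ∀ s, 0 ≤ φ s ∧ φ s ≤ β - 1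

/-! ### The multi-agent decoupling coefficient -/

/-- The inequality that defines the decoupling coefficient, for functions `f_t, g_t ∈ F` that
induce `π_t = (μ_{f_t}, ν_{f_t,g_t})` and for the `𝒯^{μ_{f_t}}`-residuals of `e_t ∈ F`. -/
def DecouplingIneq {M : MarkovGame X A B} {F : FunClass M} (σ : Selector X A B) (T : ℕ)
    (m K : ℝ) (f g e : ℕ → Mem F) : Prop :=
  |∑ h : Fin M.H, ∑ t ∈ Finset.range T,
      ∫ ζ, residual (σ.maxPolicy (f t)) (e t) h (ζ h)
        ∂(episodeLaw M (σ.maxPolicy (f t)) (σ.minPolicy (f t) (g t)))| ≤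
    m * ∑ h : Fin M.H, ∑ t ∈ Finset.range T, ∑ s ∈ Finset.range t,
      ∫ ζ, (residual (σ.maxPolicy (f t)) (e t) h (ζ h)) ^ 2
        ∂(episodeLaw M (σ.maxPolicy (f s)) (σ.minPolicy (f s) (g s))) + K / (4 * m)

/-- `dc(F, MG, T, m)`: the least integer `K` such that the decoupling inequality holds for all
sequences in `F`, both for the residuals of the `f_t` (for which `𝒯^{μ_{f_t}} f_t = 𝒯 f_t`) and
for those of the `g_t`. -/
noncomputable def dc {M : MarkovGame X A B} (F : FunClass M) (σ : Selector X A B) (T : ℕ)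
    (m : ℝ) : ℕ :=
  sInf {K : ℕ | ∀ f g : ℕ → Mem F,
    DecouplingIneq σ T m K f g f ∧ DecouplingIneq σ T m K f g g}

/-! ### Conditional posterior sampling with booster, with uniform priors -/

/-- `∑_s [φ(x_s^h, a_s^h, b_s^h) - r_s^h - v_{h+1}(x_s^{h+1})]^2`, where `v_{H+1} = 0`. -/
noncomputable def loss (M : MarkovGame X A B) (v : ℕ → X → ℝ) (h : ℕ) (φ : X × A × B → ℝ)
    {t : ℕ} (S : Fin t → Trajectory M) : ℝ :=
  if hh : h < M.H then
    ∑ s : Fin t, (φ (S s ⟨h, hh⟩) - M.r h (S s ⟨h, hh⟩) -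
      if hh' : h + 1 < M.H then v (h + 1) (S s ⟨h + 1, hh'⟩).1 else 0) ^ 2
  else 0

/-- `∏_h p_0^h(f^h) exp(-η L^h(f^h)) / E_{φ ∼ p_0^h} exp(-η L^h(φ))` with `p_0^h` uniform on
`F_h`; the losses `L^h` use the next-step values `v`. -/
noncomputable def condProd {M : MarkovGame X A B} {F : FunClass M} (η : ℝ) (v : ℕ → X → ℝ)
    (f : Mem F) {t : ℕ} (S : Fin t → Trajectory M) : ℝ :=
  ∏ h : Fin M.H,
    (1 / ((F h).card : ℝ) * Real.exp (-η * loss M v h (f.comp h) S)) /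
      ∑ φ ∈ F h, 1 / ((F h).card : ℝ) * Real.exp (-η * loss M v h φ S)

/-- The posterior of the main agent, up to normalization. -/
noncomputable def mainWeight {M : MarkovGame X A B} {F : FunClass M} (η l : ℝ)
    {t : ℕ} (S : Fin t → Trajectory M) (f : Mem F) : ℝ :=
  Real.exp (l * inducedValue f 0 M.x₁) * condProd η (inducedValue f) f S

/-- The posterior `p(f | S)` of the main agent. -/
noncomputable def mainPosterior {M : MarkovGame X A B} {F : FunClass M} (η l : ℝ)
    {t : ℕ} (S : Fin t → Trajectory M) (f : Mem F) : ℝ :=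
  mainWeight η l S f / ∑ f' : Mem F, mainWeight η l S f'

/-- The posterior of the booster agent against `μ`, up to normalization. -/
noncomputable def boosterWeight {M : MarkovGame X A B} {F : FunClass M} (η l : ℝ)
    (μ : Policy X A) {t : ℕ} (S : Fin t → Trajectory M) (g : Mem F) : ℝ :=
  Real.exp (-l * inducedBrValue μ g 0 M.x₁) * condProd η (inducedBrValue μ g) g S

/-- The posterior `p^μ(g | S)` of the booster agent. -/
noncomputable def boosterPosterior {M : MarkovGame X A B} {F : FunClass M} (η l : ℝ)
    (μ : Policy X A) {t : ℕ} (S : Fin t → Trajectory M) (g : Mem F) : ℝ :=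
  boosterWeight η l μ S g / ∑ g' : Mem F, boosterWeight η l μ S g'

/-- What happens in one episode: the sampled functions `f_t`, `g_t` and the trajectory `ζ_t`. -/
abbrev Episode {M : MarkovGame X A B} (F : FunClass M) := Mem F × Mem F × Trajectory M

/-- The joint law of the first `t` episodes. Given the past, `f_{t+1}` is drawn from the main
agent's posterior, then `g_{t+1}` from the booster agent's posterior against `μ_{f_{t+1}}`, and
then the trajectory from executing `(μ_{f_{t+1}}, ν_{f_{t+1},g_{t+1}})`. -/
noncomputable def processLaw {M : MarkovGame X A B} (F : FunClass M) (σ : Selector X A B)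
    (η l : ℝ) : (t : ℕ) → Measure (Fin t → Episode F)
  | 0 => Measure.dirac Fin.elim0
  | t + 1 => ∑ f : Mem F, ∑ g : Mem F,
      ((((processLaw F σ η l t).withDensity fun ω =>
          ENNReal.ofReal (mainPosterior η l (fun s => (ω s).2.2) f *
            boosterPosterior η l (σ.maxPolicy f) (fun s => (ω s).2.2) g)).prod
        (episodeLaw M (σ.maxPolicy f) (σ.minPolicy f g))).map
          (fun p : (Fin t → Episode F) × Trajectory M =>
            (Fin.snoc p.1 ((f, g, p.2) : Episode F) : Fin (t + 1) → Episode F)))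

/-- The expected regret of the max-player over `T` episodes,
`E ∑_{t ≤ T} [V_1^*(x^1) - V_1^{μ_t,†}(x^1)]`, where `V^* = V^{μ^*,ν^*}`. -/
noncomputable def expectedRegret {M : MarkovGame X A B} (F : FunClass M) (σ : Selector X A B)
    (μs : Policy X A) (νs : Policy X B) (η l : ℝ) (T : ℕ) : ℝ :=
  ∫ ω, ∑ t : Fin T,
    (value M μs νs 0 M.x₁ - brValue M (σ.maxPolicy (ω t).1) 0 M.x₁) ∂(processLaw F σ η l T)

end Game

end ZeroSumMG

open ZeroSumMG

namespace ZeroSumMG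

/-! In a round with sampled f, g put μ = μ_f and ν = ν_{f,g}. At the initial state, V* - V^{μ,†} is
the sum of V* - V_f, V_f - V^{μ,ν}, V^{μ,ν} - V_g^μ and V_g^μ - V^{μ,†}. Telescoping the Bellman
equations bounds the second term by the expected Bellman residuals of f under (μ, ν), because ν is
one possible reply to μ. It bounds the third by minus those of g, because ν is a best reply for g
(`inducedBrValue_sub_value_le`, `le_inducedBrValue_sub_value`). The decoupling inequality trades
these on-policy residuals for m times the squared residuals under the policies of past episodes,
plus K / (4m).

The first and last terms, together with the squared residuals, are controlled by the posteriors.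
Each is a Gibbs distribution, so the mean of -log(weight) is at most its value at any comparator
plus log |F| (`sum_div_mul_neg_log_le`). The comparators are Q* and Q^{μ_f,†}; they lie in the class
and have zero residuals (`exists_mem_nashValue`, `exists_mem_brValue`). Apart from the optimism
factor, -log(weight) is a sum over h of log ∑_φ exp(-η (loss of φ - loss of the sampled function)).
By completeness the regression target is one of the φ. Keeping only this φ bounds the sum below by
1/25 of the squared residuals minus a fluctuation (`le_neg_log_condProd`). At a comparator the sum
is at most a fluctuation (`neg_log_condProd_le`).

The fluctuation is the log of a sum of exponential supermartingales, one for each triple (χ, ψ, φ),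
where χ fixes the next-step strategy, ψ the next-step values and φ the regression function. It
dominates all triples at once, so random f and g are allowed. Since ties are broken step by step, χ
and ψ range over F_{h+1} and φ over F_h; the logs of the numbers of triples add up to at most 3 log
|F|.

A round thus costs 2(2·3 + 1) log |F| = 14 log |F|. With m = 1/(25λ) the squares cancel, and the
regret is at most 14 T log |F| / λ + (25/2) λ D. The prescribed λ makes T log |F| / λ equal to λ D.
The requirement m ≤ 1 fails only for λ < 1/25, where cruder bounds suffice. -/

/-! ### Bounded measurable functions -/

/-- Bounded measurable real functions. -/
structure BddMeas {α : Type*} [MeasurableSpace α] (f : α → ℝ) : Prop where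
  measurable : Measurable f
  bdd : ∃ C, ∀ x, |f x| ≤ C

namespace BddMeas

variable {α β : Type*} [MeasurableSpace α] [MeasurableSpace β] {f g : α → ℝ}

lemma of_mem_Icc (hf : Measurable f) {a b : ℝ} (h : ∀ x, f x ∈ Set.Icc a b) : BddMeas f :=
  ⟨hf, max |a| |b|, fun x => abs_le_max_abs_abs (h x).1 (h x).2⟩

lemma const (c : ℝ) : BddMeas fun _ : α => c := ⟨measurable_const, |c|, fun _ => le_rfl⟩

lemma integrable (hf : BddMeas f) (μ : Measure α) [IsFiniteMeasure μ] : Integrable f μ := by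
  obtain ⟨C, hC⟩ := hf.bdd
  exact Integrable.of_bound hf.measurable.aestronglyMeasurable C (ae_of_all _ hC)

lemma add (hf : BddMeas f) (hg : BddMeas g) : BddMeas fun x => f x + g x := by
  obtain ⟨C, hC⟩ := hf.bdd
  obtain ⟨D, hD⟩ := hg.bdd
  exact ⟨hf.measurable.add hg.measurable, C + D,
    fun x => (abs_add_le _ _).trans (add_le_add (hC x) (hD x))⟩

lemma neg (hf : BddMeas f) : BddMeas fun x => -f x := by
  obtain ⟨C, hC⟩ := hf.bdd
  exact ⟨hf.measurable.neg, C, fun x => by simpa using hC x⟩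

lemma sub (hf : BddMeas f) (hg : BddMeas g) : BddMeas fun x => f x - g x := by
  simpa [sub_eq_add_neg] using hf.add hg.neg

lemma mul (hf : BddMeas f) (hg : BddMeas g) : BddMeas fun x => f x * g x := by
  obtain ⟨C, hC⟩ := hf.bdd
  obtain ⟨D, hD⟩ := hg.bdd
  refine ⟨hf.measurable.mul hg.measurable, C * D, fun x => ?_⟩
  rw [abs_mul]
  exact mul_le_mul (hC x) (hD x) (abs_nonneg _) ((abs_nonneg _).trans (hC x))

lemma pow (hf : BddMeas f) (n : ℕ) : BddMeas fun x => f x ^ n := by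
  obtain ⟨C, hC⟩ := hf.bdd
  refine ⟨hf.measurable.pow_const n, C ^ n, fun x => ?_⟩
  rw [abs_pow]
  exact pow_le_pow_left₀ (abs_nonneg _) (hC x) n

lemma exp (hf : BddMeas f) : BddMeas fun x => Real.exp (f x) := by
  obtain ⟨C, hC⟩ := hf.bdd
  refine ⟨hf.measurable.exp, Real.exp C, fun x => ?_⟩
  rw [abs_of_pos (Real.exp_pos _)]
  exact Real.exp_le_exp.2 ((le_abs_self _).trans (hC x))

lemma sum {ι : Type*} (s : Finset ι) {f : ι → α → ℝ} (hf : ∀ i ∈ s, BddMeas (f i)) :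
    BddMeas fun x => ∑ i ∈ s, f i x := by
  classical
  induction s using Finset.induction_on with
  | empty => simpa using BddMeas.const 0
  | insert i s hi ih =>
    simp only [Finset.sum_insert hi]
    exact (hf i (Finset.mem_insert_self _ _)).add
      (ih fun j hj => hf j (Finset.mem_insert_of_mem hj))

lemma comp (hf : BddMeas f) {u : β → α} (hu : Measurable u) : BddMeas fun y => f (u y) := by
  obtain ⟨C, hC⟩ := hf.bdd
  exact ⟨hf.measurable.comp hu, C, fun x => hC _⟩

lemma integral_kernel {f : α × β → ℝ} (hf : BddMeas f) (κ : Kernel α β) [IsMarkovKernel κ] :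
    BddMeas fun x => ∫ y, f (x, y) ∂(κ x) := by
  obtain ⟨C, hC⟩ := hf.bdd
  refine ⟨(hf.measurable.stronglyMeasurable.integral_kernel_prod_right' (κ := κ)).measurable, C,
    fun x => ?_⟩
  simpa using norm_integral_le_of_norm_le_const (μ := κ x)
    (ae_of_all _ fun y => (by simpa using hC (x, y) : ‖f (x, y)‖ ≤ C))

end BddMeas

section Game

variable {X A B : Type*} [MeasurableSpace X] [MeasurableSpace A] [MeasurableSpace B]

instance (κ : MKernel X A) : IsMarkovKernel κ.1 := κ.2

instance (M : MarkovGame X A B) (h : ℕ) : IsMarkovKernel (M.P h) := M.isMarkov_P h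

/-! ### Integration along trajectories -/

lemma measurable_cons {Z : Type*} [MeasurableSpace Z] (n : ℕ) :
    Measurable fun p : Z × (Fin n → Z) => (Fin.cons p.1 p.2 : Fin (n + 1) → Z) := by
  refine measurable_pi_iff.2 fun i => ?_
  refine Fin.cases ?_ (fun j => ?_) i
  · simpa using measurable_fst
  · simp only [Fin.cons_succ]
    fun_prop

instance isMarkovKernel_traj (M : MarkovGame X A B) (μ : Policy X A) (ν : Policy X B) :
    ∀ n h, IsMarkovKernel (traj M μ ν n h)
  | 0, h => by unfold traj; infer_instance
  | n + 1, h => by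
    have := isMarkovKernel_traj M μ ν n (h + 1)
    unfold traj
    exact Kernel.IsMarkovKernel.map _ (measurable_cons n)

instance (M : MarkovGame X A B) (μ : Policy X A) (ν : Policy X B) :
    IsProbabilityMeasure (episodeLaw M μ ν) := by
  unfold episodeLaw; infer_instance

lemma integral_id_prod {α β : Type*} [MeasurableSpace α] [MeasurableSpace β] (κ : Kernel α β)
    [IsMarkovKernel κ] (x : α) {f : α × β → ℝ} (hf : BddMeas f) :
    ∫ p, f p ∂((Kernel.id ×ₖ κ) x) = ∫ y, f (x, y) ∂(κ x) := by
  rw [Kernel.prod_apply, Kernel.id_apply, integral_prod _ (hf.integrable _)]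
  have h : BddMeas fun z => ∫ y, f (z, y) ∂(κ x) := hf.integral_kernel (Kernel.const α (κ x))
  exact integral_dirac' _ _ h.measurable.stronglyMeasurable

/-- The Markov property at the first step, obtained by unfolding the recursion and applying Fubini.
Every induction along trajectories rests on it. -/
lemma integral_traj_succ (M : MarkovGame X A B) (μ : Policy X A) (ν : Policy X B) (n h : ℕ)
    (x : X) {f : (Fin (n + 1) → X × A × B) → ℝ} (hf : BddMeas f) :
    ∫ ζ, f ζ ∂(traj M μ ν (n + 1) h x) =
      ∫ c, ∫ x', ∫ ζ, f (Fin.cons (x, c) ζ) ∂(traj M μ ν n (h + 1) x') ∂(M.P h (x, c))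
        ∂(((μ h).1 ×ₖ (ν h).1) x) := by
  have hc := measurable_cons (Z := X × A × B) n
  have hf' : BddMeas fun p : (X × A × B) × (Fin n → X × A × B) =>
      f (Fin.cons p.1 p.2 : Fin (n + 1) → X × A × B) := hf.comp hc
  rw [traj, Kernel.map_apply _ hc, integral_map hc.aemeasurable
    hf.measurable.aestronglyMeasurable, Kernel.integral_comp (hf'.integrable _)]
  have h1 : ∀ z : X × A × B,
      ∫ p, f (Fin.cons p.1 p.2 : Fin (n + 1) → X × A × B)
        ∂((Kernel.id ×ₖ (traj M μ ν n (h + 1) ∘ₖ M.P h)) z) =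
      ∫ x', ∫ ζ, f (Fin.cons z ζ) ∂(traj M μ ν n (h + 1) x') ∂(M.P h z) := fun z => by
    rw [integral_id_prod _ _ hf']
    rw [Kernel.integral_comp]
    exact (hf'.comp (measurable_const.prodMk measurable_id)).integrable _
  simp_rw [h1]
  rw [integral_id_prod]
  have h2 : BddMeas fun q : (X × A × B) × X =>
      ∫ ζ, f (Fin.cons q.1 ζ) ∂(traj M μ ν n (h + 1) q.2) :=
    BddMeas.integral_kernel (f := fun q : ((X × A × B) × X) × (Fin n → X × A × B) =>
      f (Fin.cons q.1.1 q.2)) (hf'.comp (u := fun q : ((X × A × B) × X) × (Fin n → X × A × B) =>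
        (q.1.1, q.2)) (by fun_prop)) ((traj M μ ν n (h + 1)).comap Prod.snd
        measurable_snd)
  exact h2.integral_kernel (M.P h)

lemma traj_congr (M : MarkovGame X A B) {μ μ' : Policy X A} {ν ν' : Policy X B} (n h : ℕ)
    (hμ : ∀ k, h ≤ k → μ k = μ' k) (hν : ∀ k, h ≤ k → ν k = ν' k) :
    traj M μ ν n h = traj M μ' ν' n h := by
  induction n generalizing h with
  | zero => rfl
  | succ n ih =>
    simp only [traj]
    rw [ih (h + 1) (fun k hk => hμ k (by omega)) fun k hk => hν k (by omega), hμ h le_rfl,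
      hν h le_rfl]

/-- The expected sum of `ρ` over `n` consecutive steps. -/
noncomputable def trajSum (M : MarkovGame X A B) (μ : Policy X A) (ν : Policy X B)
    (ρ : ℕ → X × A × B → ℝ) (n h : ℕ) (x : X) : ℝ :=
  ∫ ζ, ∑ i : Fin n, ρ (h + i) (ζ i) ∂(traj M μ ν n h x)

lemma bddMeas_sum_traj {ρ : ℕ → X × A × B → ℝ} (n h : ℕ)
    (hρ : ∀ k, h ≤ k → k < h + n → BddMeas (ρ k)) :
    BddMeas fun ζ : Fin n → X × A × B => ∑ i : Fin n, ρ (h + i) (ζ i) :=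
  BddMeas.sum _ fun i _ => (hρ (h + i) (by omega) (by omega)).comp (measurable_pi_apply i)

lemma bddMeas_trajSum (M : MarkovGame X A B) (μ : Policy X A) (ν : Policy X B)
    {ρ : ℕ → X × A × B → ℝ} (n h : ℕ) (hρ : ∀ k, h ≤ k → k < h + n → BddMeas (ρ k)) :
    BddMeas (trajSum M μ ν ρ n h) :=
  BddMeas.integral_kernel (f := fun p : X × (Fin n → X × A × B) =>
    ∑ i : Fin n, ρ (h + i) (p.2 i)) ((bddMeas_sum_traj n h hρ).comp measurable_snd) _

lemma trajSum_zero (M : MarkovGame X A B) (μ : Policy X A) (ν : Policy X B)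
    (ρ : ℕ → X × A × B → ℝ) (h : ℕ) (x : X) : trajSum M μ ν ρ 0 h x = 0 := by
  simp [trajSum]

lemma trajSum_succ (M : MarkovGame X A B) (μ : Policy X A) (ν : Policy X B)
    {ρ : ℕ → X × A × B → ℝ} (n h : ℕ) (hρ : ∀ k, h ≤ k → k < h + (n + 1) → BddMeas (ρ k))
    (x : X) :
    trajSum M μ ν ρ (n + 1) h x =
      ∫ c, (ρ h (x, c) + ∫ x', trajSum M μ ν ρ n (h + 1) x' ∂(M.P h (x, c)))
        ∂(((μ h).1 ×ₖ (ν h).1) x) := by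
  rw [trajSum, integral_traj_succ M μ ν n h x (bddMeas_sum_traj (n + 1) h hρ)]
  have hρ' : ∀ k, h + 1 ≤ k → k < h + 1 + n → BddMeas (ρ k) :=
    fun k h1 h2 => hρ k (by omega) (by omega)
  congr 1; ext c
  have h1 : ∀ x' : X, ∫ ζ, ∑ i : Fin (n + 1), ρ (h + i) ((Fin.cons (x, c) ζ :
      Fin (n + 1) → X × A × B) i) ∂(traj M μ ν n (h + 1) x') =
      ρ h (x, c) + trajSum M μ ν ρ n (h + 1) x' := fun x' => by
    simp only [Fin.sum_univ_succ, Fin.cons_zero, Fin.cons_succ, Fin.val_zero, add_zero,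
      Fin.val_succ]
    have hE : (fun ζ : Fin n → X × A × B => ∑ i : Fin n, ρ (h + (i + 1)) (ζ i)) =
        fun ζ => ∑ i : Fin n, ρ (h + 1 + i) (ζ i) := by
      ext ζ
      exact Finset.sum_congr rfl fun i _ => by rw [Nat.add_assoc, Nat.add_comm 1]
    rw [integral_add (integrable_const _)]
    · simp only [integral_const, probReal_univ, one_smul, trajSum, hE]
    · rw [hE]
      exact (bddMeas_sum_traj n (h + 1) hρ').integrable _
  simp_rw [h1]
  rw [integral_add (integrable_const _) ((bddMeas_trajSum M μ ν n (h + 1) hρ').integrable _)]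
  simp

/-- The joint law of `(x^h, a^h, b^h)` and `x^{h+1}` along a trajectory. -/
lemma integral_traj_two_step (M : MarkovGame X A B) (μ : Policy X A) (ν : Policy X B) (n h : ℕ)
    (x : X) (i : ℕ) (hi : i + 1 < n) {G : (X × A × B) × X → ℝ} (hG : BddMeas G) :
    ∫ ζ, G (ζ ⟨i, by omega⟩, (ζ ⟨i + 1, hi⟩).1) ∂(traj M μ ν n h x) =
      ∫ ζ, ∫ x', G (ζ ⟨i, by omega⟩, x') ∂(M.P (h + i) (ζ ⟨i, by omega⟩))
        ∂(traj M μ ν n h x) := by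
  induction i generalizing n h x with
  | zero =>
    obtain ⟨n, rfl⟩ : ∃ k, n = k + 2 := ⟨n - 2, by omega⟩
    rw [integral_traj_succ _ _ _ _ _ _ (hG.comp (by fun_prop)),
      integral_traj_succ _ _ _ _ _ _ ((hG.integral_kernel _).comp (by fun_prop))]
    congr 1; ext c
    have h0 : ∀ (z : X × A × B) (ζ : Fin (n + 1) → X × A × B),
        (Fin.cons z ζ : Fin (n + 2) → X × A × B) ⟨0, by omega⟩ = z := fun z ζ => rfl
    have h1 : ∀ (z : X × A × B) (ζ : Fin (n + 1) → X × A × B),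
        (Fin.cons z ζ : Fin (n + 2) → X × A × B) ⟨0 + 1, by omega⟩ = ζ 0 := fun z ζ => rfl
    simp only [h0, h1, integral_const, probReal_univ, one_smul, add_zero]
    congr 1; ext x'
    rw [integral_traj_succ _ _ _ _ _ _ (hG.comp (by fun_prop))]
    simp
  | succ i ih =>
    -- After the first step is peeled off, positions i + 1, i + 2 of the trajectory from h are
    -- positions i, i + 1 of the trajectory from h + 1.
    obtain ⟨n, rfl⟩ : ∃ k, n = k + 1 := ⟨n - 1, by omega⟩
    rw [integral_traj_succ _ _ _ _ _ _ (hG.comp (by fun_prop)),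
      integral_traj_succ _ _ _ _ _ _ ((hG.integral_kernel _).comp (by fun_prop))]
    congr 1; ext c
    congr 1; ext x'
    have := ih n (h + 1) x' (by omega)
    rw [show h + 1 + i = h + (i + 1) by omega] at this
    exact this

end Game

section Game

variable {X A B : Type*} [MeasurableSpace X] [MeasurableSpace A] [MeasurableSpace B]

/-! ### Bellman equations for a pair of policies -/

lemma bddMeas_r (M : MarkovGame X A B) (h : ℕ) : BddMeas (M.r h) :=
  .of_mem_Icc (M.measurable_r h) fun s => ⟨M.r_nonneg h s, M.r_le_one h s⟩

lemma value_eq_trajSum (M : MarkovGame X A B) (μ : Policy X A) (ν : Policy X B) (h : ℕ) (x : X) :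
    value M μ ν h x = trajSum M μ ν M.r (M.H - h) h x := rfl

lemma bddMeas_value (M : MarkovGame X A B) (μ : Policy X A) (ν : Policy X B) (h : ℕ) :
    BddMeas (value M μ ν h) :=
  bddMeas_trajSum M μ ν (M.H - h) h fun k _ _ => bddMeas_r M k

lemma value_nonneg (M : MarkovGame X A B) (μ : Policy X A) (ν : Policy X B) (h : ℕ) (x : X) :
    0 ≤ value M μ ν h x :=
  integral_nonneg fun _ => Finset.sum_nonneg fun _ _ => M.r_nonneg _ _

lemma value_of_le (M : MarkovGame X A B) (μ : Policy X A) (ν : Policy X B) {h : ℕ} (hh : M.H ≤ h)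
    (x : X) : value M μ ν h x = 0 := by
  rw [value_eq_trajSum, Nat.sub_eq_zero_of_le hh, trajSum_zero]

lemma bddMeas_qValue (M : MarkovGame X A B) (μ : Policy X A) (ν : Policy X B) (h : ℕ) :
    BddMeas (qValue M μ ν h) :=
  (bddMeas_r M h).add (((bddMeas_value M μ ν (h + 1)).comp measurable_snd).integral_kernel _)

lemma qValue_nonneg (M : MarkovGame X A B) (μ : Policy X A) (ν : Policy X B) (h : ℕ)
    (s : X × A × B) : 0 ≤ qValue M μ ν h s :=
  add_nonneg (M.r_nonneg _ _) (integral_nonneg fun _ => value_nonneg _ _ _ _ _)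

lemma value_eq_integral_qValue (M : MarkovGame X A B) (μ : Policy X A) (ν : Policy X B) {h : ℕ}
    (hh : h < M.H) (x : X) :
    value M μ ν h x = ∫ c, qValue M μ ν h (x, c) ∂(((μ h).1 ×ₖ (ν h).1) x) := by
  rw [value_eq_trajSum, show M.H - h = (M.H - (h + 1)) + 1 by omega,
    trajSum_succ M μ ν _ _ fun k _ _ => bddMeas_r M k]
  rfl

lemma value_congr (M : MarkovGame X A B) {μ μ' : Policy X A} {ν ν' : Policy X B} (h : ℕ)
    (hμ : ∀ k, h ≤ k → μ k = μ' k) (hν : ∀ k, h ≤ k → ν k = ν' k) :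
    value M μ ν h = value M μ' ν' h := by
  ext x
  simp only [value, traj_congr M (M.H - h) h hμ hν]

/-- A deviation at step h alone leaves the continuation values unchanged, since these depend only on
later steps. The Nash property is used only for such one-step deviations. -/
lemma value_update_left (M : MarkovGame X A B) (μ : Policy X A) (ν : Policy X B) {h : ℕ}
    (hh : h < M.H) (κ : MKernel X A) (x : X) :
    value M (Function.update μ h κ) ν h x =
      ∫ c, qValue M μ ν h (x, c) ∂((κ.1 ×ₖ (ν h).1) x) := by
  rw [value_eq_integral_qValue M _ _ hh]
  simp only [qValue, Function.update_self]
  rw [value_congr M (μ := Function.update μ h κ) (μ' := μ) (ν' := ν) (h + 1)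
    (fun k hk => Function.update_of_ne (by omega) _ _) fun _ _ => rfl]

lemma value_update_right (M : MarkovGame X A B) (μ : Policy X A) (ν : Policy X B) {h : ℕ}
    (hh : h < M.H) (κ : MKernel X B) (x : X) :
    value M μ (Function.update ν h κ) h x =
      ∫ c, qValue M μ ν h (x, c) ∂(((μ h).1 ×ₖ κ.1) x) := by
  rw [value_eq_integral_qValue M _ _ hh]
  simp only [qValue, Function.update_self]
  rw [value_congr M (ν := Function.update ν h κ) (μ' := μ) (ν' := ν) (h + 1)
    (fun _ _ => rfl) fun k hk => Function.update_of_ne (by omega) _ _]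

/-- Telescoping of one-sided Bellman inequalities along trajectories. -/
lemma le_trajSum (M : MarkovGame X A B) (μ : Policy X A) (ν : Policy X B) {v : ℕ → X → ℝ}
    {g : ℕ → X × A × B → ℝ} (hv : ∀ k, BddMeas (v k)) (hg : ∀ k, BddMeas (g k)) (n h : ℕ)
    (hle : ∀ k x, h ≤ k → k < h + n → v k x ≤ ∫ c, g k (x, c) ∂(((μ k).1 ×ₖ (ν k).1) x))
    (hend : ∀ x, v (h + n) x ≤ 0) (x : X) :
    v h x ≤ trajSum M μ ν (fun k s => g k s - ∫ x', v (k + 1) x' ∂(M.P k s)) n h x := by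
  have hρ : ∀ k, BddMeas fun s => g k s - ∫ x', v (k + 1) x' ∂(M.P k s) := fun k =>
    (hg k).sub (((hv (k + 1)).comp measurable_snd).integral_kernel _)
  induction n generalizing h x with
  | zero => simpa [trajSum_zero] using hend x
  | succ n ih =>
    rw [trajSum_succ M μ ν n h fun k _ _ => hρ k]
    refine (hle h x le_rfl (by omega)).trans ?_
    have hS := bddMeas_trajSum M μ ν n (h + 1) (fun k _ _ => hρ k)
    have hc : Measurable fun c : A × B => (x, c) := measurable_prodMk_left
    refine integral_mono (((hg h).comp hc).integrable _)
      ((((hρ h).add ((hS.comp measurable_snd).integral_kernel (M.P h))).comp hc).integrable _)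
      fun c => ?_
    have : ∫ x', v (h + 1) x' ∂(M.P h (x, c)) ≤ ∫ x', trajSum M μ ν
        (fun k s => g k s - ∫ x', v (k + 1) x' ∂(M.P k s)) n (h + 1) x' ∂(M.P h (x, c)) :=
      integral_mono ((hv _).integrable _) (hS.integrable _) fun x' =>
        ih (h + 1) (fun k x h1 h2 => hle k x (by omega) (by omega))
          (fun x => by simpa only [show h + 1 + n = h + (n + 1) by omega] using hend x) x'
    dsimp only
    linarith

lemma trajSum_episode (M : MarkovGame X A B) (μ : Policy X A) (ν : Policy X B)
    {ρ : ℕ → X × A × B → ℝ} (hρ : ∀ k < M.H, BddMeas (ρ k)) :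
    trajSum M μ ν ρ M.H 0 M.x₁ = ∑ h : Fin M.H, ∫ ζ, ρ h (ζ h) ∂(episodeLaw M μ ν) := by
  simp only [trajSum, zero_add]
  exact integral_finsetSum _ fun i _ =>
    ((hρ i i.2).comp (measurable_pi_apply i)).integrable (episodeLaw M μ ν)

/-! ### Matrix games -/

lemma payoff_eq_integral_prod {φ : X × A × B → ℝ} (hφ : BddMeas φ) (κ : Kernel X A)
    (η : Kernel X B) [IsMarkovKernel κ] [IsMarkovKernel η] (x : X) :
    payoff (fun a b => φ (x, a, b)) (κ x) (η x) = ∫ c, φ (x, c) ∂((κ ×ₖ η) x) := by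
  rw [Kernel.prod_apply, integral_prod _ ((hφ.comp measurable_prodMk_left).integrable _)]
  rfl

lemma payoff_nonneg {G : A → B → ℝ} (hG : ∀ a b, 0 ≤ G a b) (p : Measure A) (q : Measure B) :
    0 ≤ payoff G p q :=
  integral_nonneg fun a => integral_nonneg fun b => hG a b

lemma minPayoff_le {G : A → B → ℝ} (hG : ∀ a b, 0 ≤ G a b) (p : Measure A) (q : Measure B)
    [hq : IsProbabilityMeasure q] : minPayoff G p ≤ payoff G p q :=
  ciInf_le (f := fun q : ProbabilityMeasure B => payoff G p q)
    ⟨0, by rintro _ ⟨q, rfl⟩; exact payoff_nonneg hG _ _⟩ ⟨q, hq⟩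

lemma minPayoff_eq_of_isBestReply {G : A → B → ℝ} (hG : ∀ a b, 0 ≤ G a b) {p : Measure A}
    {q : Measure B} [hq : IsProbabilityMeasure q] (h : IsBestReply G p q) :
    minPayoff G p = payoff G p q := by
  have : Nonempty (ProbabilityMeasure B) := ⟨⟨q, hq⟩⟩
  exact le_antisymm (minPayoff_le hG p q) (le_ciInf h)

lemma gameValue_eq_of_isMaximin {G : A → B → ℝ} {p : Measure A}
    [hp : IsProbabilityMeasure p] (h : IsMaximin G p) : gameValue G = minPayoff G p := by
  have : Nonempty (ProbabilityMeasure A) := ⟨⟨p, hp⟩⟩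
  exact le_antisymm (ciSup_le h) (le_ciSup (f := fun p : ProbabilityMeasure A =>
    minPayoff G (p : Measure A)) ⟨minPayoff G p, by rintro _ ⟨q, rfl⟩; exact h q⟩ ⟨p, hp⟩)

lemma payoff_zero (p : Measure A) (q : Measure B) : payoff (fun _ _ => 0) p q = 0 := by
  simp [payoff]

lemma minPayoff_zero (p : Measure A) : minPayoff (fun (_ : A) (_ : B) => (0 : ℝ)) p = 0 := by
  simp [minPayoff, payoff_zero]

/-! ### Function classes -/

/-- The standing assumptions on a function class and a tie-breaking rule. -/
structure Regular {M : MarkovGame X A B} (F : FunClass M) (σ : Selector X A B) : Prop where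
  isOptimal : σ.IsOptimal F
  measurable : ∀ h : Fin M.H, ∀ φ ∈ F h, Measurable φ
  boundedBy : BoundedBy F 2

/-- The class `F_h`, which is `{0}` past the last step. -/
noncomputable def stepClass {M : MarkovGame X A B} (F : FunClass M) (h : ℕ) :
    Finset (X × A × B → ℝ) :=
  if hh : h < M.H then F ⟨h, hh⟩ else {0}

lemma stepClass_fin {M : MarkovGame X A B} (F : FunClass M) (h : Fin M.H) :
    stepClass F h = F h := by
  simp [stepClass]

lemma stepClass_of_le {M : MarkovGame X A B} (F : FunClass M) {h : ℕ} (hh : M.H ≤ h) :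
    stepClass F h = {0} := by
  simp [stepClass, not_lt.2 hh]

lemma comp_mem_stepClass {M : MarkovGame X A B} {F : FunClass M} (f : Mem F) (h : ℕ) :
    f.comp h ∈ stepClass F h := by
  unfold stepClass Mem.comp
  split_ifs with hh
  · exact (f ⟨h, hh⟩).2
  · simp

lemma comp_of_lt {M : MarkovGame X A B} {F : FunClass M} (f : Mem F) {h : ℕ} (hh : h < M.H) :
    f.comp h = (f ⟨h, hh⟩).1 := by
  simp [Mem.comp, hh]

/-- `min_q μ_h(x)^⊤ ψ(x,·,·) q`, where `μ_h` is the strategy that is induced by `χ`. -/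
noncomputable def Selector.brVal (σ : Selector X A B) (h : ℕ) (χ ψ : X × A × B → ℝ) (x : X) : ℝ :=
  minPayoff (fun a b => ψ (x, a, b)) ((σ.max h χ).1 x)

lemma inducedBrValue_maxPolicy {M : MarkovGame X A B} {F : FunClass M} (σ : Selector X A B)
    (f g : Mem F) (h : ℕ) :
    inducedBrValue (σ.maxPolicy f) g h = σ.brVal h (f.comp h) (g.comp h) := rfl

namespace Regular

variable {M : MarkovGame X A B} {F : FunClass M} {σ : Selector X A B}

lemma measurable_of_mem (R : Regular F σ) {h : ℕ} {φ : X × A × B → ℝ} (hφ : φ ∈ stepClass F h) :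
    Measurable φ := by
  unfold stepClass at hφ
  split_ifs at hφ with hh
  · exact R.measurable _ _ hφ
  · rw [Finset.mem_singleton.1 hφ]; exact measurable_const

lemma mem_Icc_of_mem (R : Regular F σ) {h : ℕ} {φ : X × A × B → ℝ} (hφ : φ ∈ stepClass F h)
    (s : X × A × B) : φ s ∈ Set.Icc (0 : ℝ) 1 := by
  unfold stepClass at hφ
  split_ifs at hφ with hh
  · have := R.boundedBy _ _ hφ s
    exact ⟨this.1, by linarith [this.2]⟩
  · rw [Finset.mem_singleton.1 hφ]; simp

lemma bddMeas_of_mem (R : Regular F σ) {h : ℕ} {φ : X × A × B → ℝ} (hφ : φ ∈ stepClass F h) :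
    BddMeas φ :=
  .of_mem_Icc (R.measurable_of_mem hφ) (R.mem_Icc_of_mem hφ)

/-- Past the last step the class is {0}, and every strategy is optimal in the zero game. -/
lemma isMaximin (R : Regular F σ) {h : ℕ} {φ : X × A × B → ℝ} (hφ : φ ∈ stepClass F h) (x : X) :
    IsMaximin (fun a b => φ (x, a, b)) ((σ.max h φ).1 x) := by
  unfold stepClass at hφ
  split_ifs at hφ with hh
  · exact R.isOptimal.max_isMaximin ⟨h, hh⟩ φ hφ x
  · intro p'
    simp [Finset.mem_singleton.1 hφ, minPayoff_zero]

lemma isBestReply (R : Regular F σ) {h : ℕ} {φ ψ : X × A × B → ℝ} (hφ : φ ∈ stepClass F h)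
    (hψ : ψ ∈ stepClass F h) (x : X) :
    IsBestReply (fun a b => ψ (x, a, b)) ((σ.max h φ).1 x) ((σ.min h φ ψ).1 x) := by
  unfold stepClass at hφ hψ
  split_ifs at hφ hψ with hh
  · exact R.isOptimal.min_isBestReply ⟨h, hh⟩ φ hφ ψ hψ x
  · intro q'
    simp [Finset.mem_singleton.1 hψ, payoff_zero]

/-- The selected reply attains the minimum, so an infimum over all distributions becomes an integral
against a Markov kernel. This is what makes the induced values measurable in the state. -/
lemma brVal_eq (R : Regular F σ) {h : ℕ} {χ ψ : X × A × B → ℝ} (hχ : χ ∈ stepClass F h)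
    (hψ : ψ ∈ stepClass F h) (x : X) :
    σ.brVal h χ ψ x = ∫ c, ψ (x, c) ∂(((σ.max h χ).1 ×ₖ (σ.min h χ ψ).1) x) := by
  rw [Selector.brVal, minPayoff_eq_of_isBestReply (fun a b => (R.mem_Icc_of_mem hψ _).1)
    (R.isBestReply hχ hψ x), payoff_eq_integral_prod (R.bddMeas_of_mem hψ)]

lemma brVal_le (R : Regular F σ) {h : ℕ} {χ ψ : X × A × B → ℝ}
    (hψ : ψ ∈ stepClass F h) (κ : MKernel X B) (x : X) :
    σ.brVal h χ ψ x ≤ ∫ c, ψ (x, c) ∂(((σ.max h χ).1 ×ₖ κ.1) x) := by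
  rw [← payoff_eq_integral_prod (R.bddMeas_of_mem hψ)]
  exact minPayoff_le (fun a b => (R.mem_Icc_of_mem hψ _).1) _ _

lemma brVal_mem_Icc (R : Regular F σ) {h : ℕ} {χ ψ : X × A × B → ℝ} (hχ : χ ∈ stepClass F h)
    (hψ : ψ ∈ stepClass F h) (x : X) : σ.brVal h χ ψ x ∈ Set.Icc (0 : ℝ) 1 := by
  rw [R.brVal_eq hχ hψ]
  refine ⟨integral_nonneg fun c => (R.mem_Icc_of_mem hψ _).1, ?_⟩
  have := integral_mono (((R.bddMeas_of_mem hψ).comp (measurable_prodMk_left (x := x))).integrable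
    (((σ.max h χ).1 ×ₖ (σ.min h χ ψ).1) x)) (integrable_const 1)
    fun c => (R.mem_Icc_of_mem hψ (x, c)).2
  simpa using this

lemma bddMeas_brVal (R : Regular F σ) {h : ℕ} {χ ψ : X × A × B → ℝ} (hχ : χ ∈ stepClass F h)
    (hψ : ψ ∈ stepClass F h) : BddMeas (σ.brVal h χ ψ) := by
  rw [funext (R.brVal_eq hχ hψ)]
  exact (R.bddMeas_of_mem hψ).integral_kernel _

lemma brVal_of_le {h : ℕ} (hh : M.H ≤ h) (χ : X × A × B → ℝ) {ψ : X × A × B → ℝ}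
    (hψ : ψ ∈ stepClass F h) (x : X) : σ.brVal h χ ψ x = 0 := by
  rw [stepClass_of_le F hh, Finset.mem_singleton] at hψ
  simp [Selector.brVal, hψ, minPayoff_zero]

/-- μ_f attains the maximum. Hence the main agent is the case g = f of the booster's objects, and
the loss estimates are needed only for pairs (f, g). -/
lemma inducedValue_eq (R : Regular F σ) (f : Mem F) :
    inducedValue f = inducedBrValue (σ.maxPolicy f) f := by
  ext h x
  exact gameValue_eq_of_isMaximin (R.isMaximin (comp_mem_stepClass f h) x)

lemma bddMeas_inducedBrValue (R : Regular F σ) (f g : Mem F) (h : ℕ) :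
    BddMeas (inducedBrValue (σ.maxPolicy f) g h) :=
  R.bddMeas_brVal (comp_mem_stepClass f h) (comp_mem_stepClass g h)

lemma bddMeas_bellman (R : Regular F σ) (f g : Mem F) (h : ℕ) :
    BddMeas (bellman (σ.maxPolicy f) g h) :=
  (bddMeas_r M h).add
    (((R.bddMeas_inducedBrValue f g (h + 1)).comp measurable_snd).integral_kernel _)

lemma bddMeas_residual (R : Regular F σ) (f g : Mem F) (h : ℕ) :
    BddMeas (residual (σ.maxPolicy f) g h) :=
  (R.bddMeas_of_mem (comp_mem_stepClass g h)).sub (R.bddMeas_bellman f g h)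

/-! ### Value decomposition through Bellman residuals -/

lemma trajSum_residual (R : Regular F σ) (f g : Mem F) (ν : Policy X B) :
    trajSum M (σ.maxPolicy f) ν (fun k s => g.comp k s -
      ∫ x', inducedBrValue (σ.maxPolicy f) g (k + 1) x' ∂(M.P k s)) M.H 0 M.x₁ =
    ∑ h : Fin M.H, ∫ ζ, residual (σ.maxPolicy f) g h (ζ h) ∂(episodeLaw M (σ.maxPolicy f) ν) +
      value M (σ.maxPolicy f) ν 0 M.x₁ := by
  have hr := R.bddMeas_residual f g
  rw [value_eq_trajSum, Nat.sub_zero, ← trajSum_episode M _ _ fun k _ => hr k, trajSum, trajSum,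
    trajSum, ← integral_add ((bddMeas_sum_traj _ _ fun k _ _ => hr k).integrable _)
      ((bddMeas_sum_traj _ _ fun k _ _ => bddMeas_r M k).integrable _)]
  congr 1; ext ζ
  rw [← Finset.sum_add_distrib]
  refine Finset.sum_congr rfl fun i _ => ?_
  simp only [residual, bellman]
  ring

/-- Value decomposition, one-sided for general replies. -/
lemma inducedBrValue_sub_value_le (R : Regular F σ) (f g : Mem F) (ν : Policy X B) :
    inducedBrValue (σ.maxPolicy f) g 0 M.x₁ - value M (σ.maxPolicy f) ν 0 M.x₁ ≤
      ∑ h : Fin M.H, ∫ ζ, residual (σ.maxPolicy f) g h (ζ h)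
        ∂(episodeLaw M (σ.maxPolicy f) ν) := by
  have := le_trajSum M (σ.maxPolicy f) ν (R.bddMeas_inducedBrValue f g)
    (fun k => R.bddMeas_of_mem (comp_mem_stepClass g k)) M.H 0
    (fun k x _ _ => R.brVal_le (comp_mem_stepClass g k) (ν k) x)
    (fun x => (brVal_of_le (by omega) _ (comp_mem_stepClass g (0 + M.H)) x).le) M.x₁
  rw [R.trajSum_residual] at this
  linarith

/-- Against ν_{f,g} the Bellman inequality for g is an equality, so the telescoping lemma also
applies to the negated functions. -/
lemma le_inducedBrValue_sub_value (R : Regular F σ) (f g : Mem F) :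
    ∑ h : Fin M.H, ∫ ζ, residual (σ.maxPolicy f) g h (ζ h)
        ∂(episodeLaw M (σ.maxPolicy f) (σ.minPolicy f g)) ≤
      inducedBrValue (σ.maxPolicy f) g 0 M.x₁ -
        value M (σ.maxPolicy f) (σ.minPolicy f g) 0 M.x₁ := by
  have := le_trajSum M (σ.maxPolicy f) (σ.minPolicy f g)
    (fun k => (R.bddMeas_inducedBrValue f g k).neg)
    (fun k => (R.bddMeas_of_mem (comp_mem_stepClass g k)).neg) M.H 0
    (fun k x _ _ => by
      rw [integral_neg]
      exact (neg_inj.2 (R.brVal_eq (comp_mem_stepClass f k) (comp_mem_stepClass g k) x)).le)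
    (fun x => by
      rw [inducedBrValue_maxPolicy,
        brVal_of_le (by omega) _ (comp_mem_stepClass g (0 + M.H)) x, neg_zero]) M.x₁
  have h2 := R.trajSum_residual f g (σ.minPolicy f g)
  have h3 : trajSum M (σ.maxPolicy f) (σ.minPolicy f g) (fun k s => -g.comp k s -
      ∫ x', -inducedBrValue (σ.maxPolicy f) g (k + 1) x' ∂(M.P k s)) M.H 0 M.x₁ =
      -trajSum M (σ.maxPolicy f) (σ.minPolicy f g) (fun k s => g.comp k s -
      ∫ x', inducedBrValue (σ.maxPolicy f) g (k + 1) x' ∂(M.P k s)) M.H 0 M.x₁ := by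
    rw [trajSum, trajSum, ← integral_neg]
    congr 1; ext ζ
    rw [← Finset.sum_neg_distrib]
    refine Finset.sum_congr rfl fun i _ => ?_
    rw [integral_neg]
    ring
  rw [h3, h2] at this
  linarith

end Regular

/-! ### The comparators -/

variable {M : MarkovGame X A B} {F : FunClass M} {σ : Selector X A B}

lemma brQValue_le (M : MarkovGame X A B) (μ : Policy X A) (ν : Policy X B) (h : ℕ)
    (s : X × A × B) : brQValue M μ h s ≤ qValue M μ ν h s :=
  ciInf_le (f := fun ν => qValue M μ ν h s)
    ⟨0, by rintro _ ⟨q, rfl⟩; exact qValue_nonneg _ _ _ _ _⟩ ν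

lemma brValue_le (M : MarkovGame X A B) (μ : Policy X A) (ν : Policy X B) (h : ℕ)
    (x : X) : brValue M μ h x ≤ value M μ ν h x :=
  ciInf_le (f := fun ν => value M μ ν h x)
    ⟨0, by rintro _ ⟨q, rfl⟩; exact value_nonneg _ _ _ _ _⟩ ν

lemma brValue_nonneg (M : MarkovGame X A B) (μ : Policy X A) (h : ℕ) (x : X) :
    0 ≤ brValue M μ h x :=
  Real.iInf_nonneg fun _ => value_nonneg _ _ _ _ _

/-- The best-reply values against an induced policy are represented in the class, with vanishing
Bellman residuals. -/
lemma exists_mem_brValue (R : Regular F σ) (f : Mem F)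
    (hF : ∀ h : Fin M.H, brQValue M (σ.maxPolicy f) h ∈ F h) :
    ∃ g : Mem F, inducedBrValue (σ.maxPolicy f) g 0 M.x₁ = brValue M (σ.maxPolicy f) 0 M.x₁ ∧
      ∀ h < M.H, ∀ s, residual (σ.maxPolicy f) g h s = 0 := by
  let g : Mem F := fun h => ⟨_, hF h⟩
  have hg : ∀ h < M.H, g.comp h = brQValue M (σ.maxPolicy f) h := fun h hh => comp_of_lt g hh
  set μ := σ.maxPolicy f with hμ
  set ν := σ.minPolicy f g with hν
  -- If one policy ν is optimal from all next states simultaneously, the infimum over replies passes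
  -- inside the transition integral.
  have hq : ∀ h, (∀ (ν' : Policy X B) x, value M μ ν (h + 1) x ≤ value M μ ν' (h + 1) x) →
      brQValue M μ h = qValue M μ ν h := fun h ih => by
    have : Nonempty (Policy X B) := ⟨ν⟩
    ext s
    refine le_antisymm (brQValue_le _ _ _ _ _) (le_ciInf fun ν' => ?_)
    exact add_le_add le_rfl (integral_mono ((bddMeas_value ..).integrable _)
      ((bddMeas_value ..).integrable _) (ih ν'))
  -- Backward induction: ν is an optimal reply to μ from every state, and the values induced by g
  -- are those of (μ, ν).
  have key : ∀ n h, h + n = M.H →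
      (∀ (ν' : Policy X B) x, value M μ ν h x ≤ value M μ ν' h x) ∧
      ∀ x, inducedBrValue μ g h x = value M μ ν h x := by
    intro n
    induction n with
    | zero =>
      intro h hh
      refine ⟨fun ν' x => by rw [value_of_le _ _ _ (by omega), value_of_le _ _ _ (by omega)],
        fun x => ?_⟩
      rw [value_of_le _ _ _ (by omega)]
      exact Regular.brVal_of_le (by omega) _ (comp_mem_stepClass g h) x
    | succ n ih =>
      intro h hh
      have hlt : h < M.H := by omega
      have hQ := hq h (ih (h + 1) (by omega)).1
      have hV : ∀ x, inducedBrValue μ g h x = value M μ ν h x := fun x => by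
        rw [value_eq_integral_qValue M _ _ hlt, ← hQ, ← hg h hlt]
        exact R.brVal_eq (comp_mem_stepClass f h) (comp_mem_stepClass g h) x
      refine ⟨fun ν' x => ?_, hV⟩
      rw [← hV x]
      refine (R.brVal_le (comp_mem_stepClass g h) (ν' h) x).trans ?_
      rw [value_eq_integral_qValue M _ _ hlt]
      refine integral_mono (((R.bddMeas_of_mem (comp_mem_stepClass g h)).comp
        measurable_prodMk_left).integrable _)
        (((bddMeas_qValue ..).comp measurable_prodMk_left).integrable _) fun c => ?_
      rw [hg h hlt]
      exact brQValue_le _ _ _ _ _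
  have : Nonempty (Policy X B) := ⟨ν⟩
  refine ⟨g, ?_, fun h hh s => ?_⟩
  · rw [(key M.H 0 (by omega)).2]
    exact le_antisymm (le_ciInf fun ν' => (key M.H 0 (by omega)).1 ν' _) (brValue_le _ _ _ _ _)
  · obtain ⟨h1, h2⟩ := key (M.H - (h + 1)) (h + 1) (by omega)
    rw [residual, bellman, hg h hh, hq h h1, qValue, funext h2, sub_self]

/-- The Nash values are represented in the class, with vanishing Bellman residuals. -/
lemma exists_mem_nashValue (R : Regular F σ) {μs : Policy X A} {νs : Policy X B}
    (hN : IsNash M μs νs) (hF : ∀ h : Fin M.H, qValue M μs νs h ∈ F h) :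
    ∃ f : Mem F, inducedBrValue (σ.maxPolicy f) f 0 M.x₁ = value M μs νs 0 M.x₁ ∧
      ∀ h < M.H, ∀ s, residual (σ.maxPolicy f) f h s = 0 := by
  let f : Mem F := fun h => ⟨_, hF h⟩
  have hf : ∀ h < M.H, f.comp h = qValue M μs νs h := fun h hh => comp_of_lt f hh
  have hV : ∀ h x, inducedBrValue (σ.maxPolicy f) f h x = value M μs νs h x := by
    intro h x
    rcases le_or_gt M.H h with hh | hh
    · rw [value_of_le _ _ _ hh]
      exact Regular.brVal_of_le hh _ (comp_mem_stepClass f h) x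
    · have hm := comp_mem_stepClass f h
      refine le_antisymm ?_ ?_
      -- Let the min-player reply with ν*: what remains is a one-step deviation of the max-player
      -- from the equilibrium.
      · refine (R.brVal_le hm (νs h) x).trans ?_
        rw [hf h hh]
        exact (value_update_left M μs νs hh _ x).symm.le.trans ((hN h hh x).1 _)
      -- The maximin strategy guarantees at least as much as μ*_h(x), against which any q is a
      -- one-step deviation of the min-player.
      · have hp : IsProbabilityMeasure ((μs h).1 x) := inferInstance
        refine le_trans ?_ (R.isMaximin hm x ⟨_, hp⟩)
        have : Nonempty (ProbabilityMeasure B) := ⟨⟨(νs h).1 x, inferInstance⟩⟩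
        refine le_ciInf fun q => ?_
        -- Playing q at all states gives an admissible policy; only its effect at x matters.
        let κ : MKernel X B := ⟨Kernel.const X (q : Measure B), inferInstance⟩
        have h1 := (hN h hh x).2 (Function.update νs h κ)
        rw [value_update_right M μs νs hh, ← hf h hh,
          ← payoff_eq_integral_prod (R.bddMeas_of_mem hm)] at h1
        exact h1
  refine ⟨f, hV 0 _, fun h hh s => ?_⟩
  rw [residual, bellman, hf h hh, funext (hV (h + 1)), qValue, sub_self]

end Game

section Game

variable {X A B : Type*} [MeasurableSpace X] [MeasurableSpace A] [MeasurableSpace B]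

/-! ### Exponential moments of excess losses -/

/-- The exponent is -e²/10 + (e/5)(v - d), with v - d centred and bounded by 1. From exp y ≤ 1 + y +
y² for |y| ≤ 1, the linear term contributes a factor of at most 1 + e²/25 ≤ exp(e²/25), and 1/10 -
1/25 = 3/50. -/
lemma integral_exp_excess_le {α : Type*} [MeasurableSpace α] (P : Measure α)
    [IsProbabilityMeasure P] {v : α → ℝ} (hv : Measurable v) (h01 : ∀ x, v x ∈ Set.Icc (0 : ℝ) 1)
    {e d : ℝ} (he : |e| ≤ 2) (hd : d = ∫ x, v x ∂P) :
    ∫ x, Real.exp (-(1 / 10) * ((e + (d - v x)) ^ 2 - (d - v x) ^ 2)) ∂P ≤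
      Real.exp (-(3 / 50) * e ^ 2) := by
  have hb : BddMeas v := .of_mem_Icc hv h01
  have hd0 : 0 ≤ d := hd ▸ integral_nonneg fun x => (h01 x).1
  have hd1 : d ≤ 1 := by
    have := integral_mono (hb.integrable P) (integrable_const 1) fun x => (h01 x).2
    rw [hd]; simpa using this
  have hpt : ∀ x, Real.exp (-(1 / 10) * ((e + (d - v x)) ^ 2 - (d - v x) ^ 2)) ≤
      Real.exp (-(1 / 10) * e ^ 2) * (1 + 1 / 25 * e ^ 2 + 1 / 5 * e * (v x - d)) := fun x => by
    have hx := h01 x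
    have h1 : |v x - d| ≤ 1 := abs_le.2 ⟨by linarith [hx.1], by linarith [hx.2]⟩
    have h2 : |1 / 5 * e * (v x - d)| ≤ 1 := by
      rw [abs_mul, abs_mul, abs_of_pos (by norm_num : (0 : ℝ) < 1 / 5)]
      nlinarith [abs_nonneg e, abs_nonneg (v x - d)]
    have h3 := (abs_le.1 (Real.abs_exp_sub_one_sub_id_le h2)).2
    have h4 : (v x - d) ^ 2 ≤ 1 := by
      rw [← sq_abs]; exact pow_le_one₀ (abs_nonneg _) h1
    have h5 : (1 / 5 * e * (v x - d)) ^ 2 ≤ 1 / 25 * e ^ 2 := by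
      nlinarith [sq_nonneg e]
    rw [show -(1 / 10) * ((e + (d - v x)) ^ 2 - (d - v x) ^ 2) =
      -(1 / 10) * e ^ 2 + 1 / 5 * e * (v x - d) by ring, Real.exp_add]
    exact mul_le_mul_of_nonneg_left (by linarith) (Real.exp_pos _).le
  have hc := BddMeas.const (α := α)
  refine (integral_mono (BddMeas.integrable
      ((hc (-(1 / 10))).mul ((((hc e).add ((hc d).sub hb)).pow 2).sub
        (((hc d).sub hb).pow 2))).exp P)
    (BddMeas.integrable ((hc _).mul ((hc (1 + 1 / 25 * e ^ 2)).add
      ((hc (1 / 5 * e)).mul (hb.sub (hc d))))) P) hpt).trans ?_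
  have hi : Integrable (fun x => 1 / 5 * e * (v x - d)) P :=
    ((hc (1 / 5 * e)).mul (hb.sub (hc d))).integrable P
  rw [integral_const_mul, integral_add (integrable_const _) hi, integral_const_mul,
    integral_sub (hb.integrable P) (integrable_const _)]
  simp only [integral_const, probReal_univ, one_smul, ← hd, sub_self, mul_zero, add_zero]
  rw [show -(3 / 50) * e ^ 2 = -(1 / 10) * e ^ 2 + 1 / 25 * e ^ 2 by ring, Real.exp_add]
  refine mul_le_mul_of_nonneg_left ?_ (Real.exp_pos _).le
  linarith [Real.add_one_le_exp (1 / 25 * e ^ 2)]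

/-- The regression target `r^h + E V_{ψ,h+1}`, with the values of `ψ` against the strategy that is
induced by `χ`. -/
noncomputable def Selector.target (σ : Selector X A B) (M : MarkovGame X A B) (h : ℕ)
    (χ ψ : X × A × B → ℝ) (s : X × A × B) : ℝ :=
  M.r h s + ∫ x', σ.brVal (h + 1) χ ψ x' ∂(M.P h s)

/-- The squared loss of `φ` in one episode in excess of that of the regression target. -/
noncomputable def Selector.excess (σ : Selector X A B) {M : MarkovGame X A B} (h : Fin M.H)
    (χ φ ψ : X × A × B → ℝ) (ζ : Trajectory M) : ℝ :=
  (φ (ζ h) - M.r h (ζ h) -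
      if hh : (h : ℕ) + 1 < M.H then σ.brVal (h + 1) χ ψ (ζ ⟨h + 1, hh⟩).1 else 0) ^ 2 -
    (σ.target M h χ ψ (ζ h) - M.r h (ζ h) -
      if hh : (h : ℕ) + 1 < M.H then σ.brVal (h + 1) χ ψ (ζ ⟨h + 1, hh⟩).1 else 0) ^ 2

/-- The mean squared deviation of `φ` from the regression target. -/
noncomputable def Selector.meanSq (σ : Selector X A B) {M : MarkovGame X A B} (h : Fin M.H)
    (χ φ ψ : X × A × B → ℝ) (μ : Policy X A) (ν : Policy X B) : ℝ :=
  ∫ ζ, (φ (ζ h) - σ.target M h χ ψ (ζ h)) ^ 2 ∂(episodeLaw M μ ν)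

namespace Regular

variable {M : MarkovGame X A B} {F : FunClass M} {σ : Selector X A B} {h : Fin M.H}
  {χ φ ψ : X × A × B → ℝ}

lemma bddMeas_target (R : Regular F σ) {h : ℕ} (hχ : χ ∈ stepClass F (h + 1))
    (hψ : ψ ∈ stepClass F (h + 1)) : BddMeas (σ.target M h χ ψ) :=
  (bddMeas_r M h).add (((R.bddMeas_brVal hχ hψ).comp measurable_snd).integral_kernel _)

lemma bddMeas_excess (R : Regular F σ) (hχ : χ ∈ stepClass F (h + 1)) (hφ : φ ∈ stepClass F h)
    (hψ : ψ ∈ stepClass F (h + 1)) : BddMeas (σ.excess h χ φ ψ) := by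
  have hev : Measurable fun ζ : Trajectory M => ζ h := measurable_pi_apply h
  have hv : BddMeas fun ζ : Trajectory M => if hh : (h : ℕ) + 1 < M.H then
      σ.brVal (h + 1) χ ψ (ζ ⟨h + 1, hh⟩).1 else 0 := by
    split_ifs with hh
    · exact (R.bddMeas_brVal hχ hψ).comp (by fun_prop)
    · exact .const 0
  exact (((((R.bddMeas_of_mem hφ).comp hev).sub ((bddMeas_r M h).comp hev)).sub hv).pow 2).sub
    (((((R.bddMeas_target hχ hψ).comp hev).sub ((bddMeas_r M h).comp hev)).sub hv).pow 2)

lemma abs_sub_target_le (R : Regular F σ) (hχ : χ ∈ stepClass F (h + 1))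
    (hφ : φ ∈ stepClass F h) (hψ : ψ ∈ stepClass F (h + 1)) (s : X × A × B) :
    |φ s - σ.target M h χ ψ s| ≤ 2 := by
  have h1 := R.mem_Icc_of_mem hφ s
  have h2 : 0 ≤ ∫ x', σ.brVal (h + 1) χ ψ x' ∂(M.P h s) :=
    integral_nonneg fun x => (R.brVal_mem_Icc hχ hψ x).1
  have h3 := integral_mono ((R.bddMeas_brVal hχ hψ).integrable (M.P h s)) (integrable_const 1)
    fun x => (R.brVal_mem_Icc hχ hψ x).2
  simp only [integral_const, probReal_univ, one_smul] at h3
  have := M.r_nonneg h s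
  have := M.r_le_one h s
  rw [Selector.target, abs_le]
  constructor <;> linarith [h1.1, h1.2]

/-- Given (x^h, a^h, b^h), the next state is a fresh draw from the transition kernel, so the
one-sample estimate applies conditionally with d the conditional mean of the next-step value. -/
lemma integral_exp_excess_le_integral (R : Regular F σ) (hχ : χ ∈ stepClass F (h + 1))
    (hφ : φ ∈ stepClass F h) (hψ : ψ ∈ stepClass F (h + 1)) (μ : Policy X A) (ν : Policy X B) :
    ∫ ζ, Real.exp (-(1 / 10) * σ.excess h χ φ ψ ζ) ∂(episodeLaw M μ ν) ≤
      ∫ ζ, Real.exp (-(3 / 50) * (φ (ζ h) - σ.target M h χ ψ (ζ h)) ^ 2)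
        ∂(episodeLaw M μ ν) := by
  have hev : Measurable fun ζ : Trajectory M => ζ h := measurable_pi_apply h
  have hb := (R.bddMeas_of_mem hφ)
  have ht := R.bddMeas_target hχ hψ
  have hr := bddMeas_r M h
  have hI : BddMeas fun s => Real.exp (-(3 / 50) * (φ s - σ.target M h χ ψ s) ^ 2) :=
    ((BddMeas.const _).mul ((hb.sub ht).pow 2)).exp
  by_cases hh : (h : ℕ) + 1 < M.H
  · have hv := R.bddMeas_brVal hχ hψ
    have hG : BddMeas fun p : (X × A × B) × X => Real.exp (-(1 / 10) *
        ((φ p.1 - M.r h p.1 - σ.brVal (h + 1) χ ψ p.2) ^ 2 -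
          (σ.target M h χ ψ p.1 - M.r h p.1 - σ.brVal (h + 1) χ ψ p.2) ^ 2)) :=
      ((BddMeas.const _).mul (((((hb.comp measurable_fst).sub (hr.comp measurable_fst)).sub
        (hv.comp measurable_snd)).pow 2).sub ((((ht.comp measurable_fst).sub
        (hr.comp measurable_fst)).sub (hv.comp measurable_snd)).pow 2))).exp
    have h2 := integral_traj_two_step M μ ν M.H 0 M.x₁ h hh hG
    simp only [zero_add] at h2
    simp only [Selector.excess, hh, dif_pos]
    rw [episodeLaw]
    refine h2.le.trans (integral_mono (((hG.integral_kernel (M.P h)).comp hev).integrable _)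
      ((hI.comp hev).integrable _) fun ζ => ?_)
    have h3 := integral_exp_excess_le (M.P h (ζ h)) hv.measurable (R.brVal_mem_Icc hχ hψ)
      (R.abs_sub_target_le hχ hφ hψ (ζ h)) rfl
    refine le_trans (le_of_eq ?_) h3
    congr 1; ext x'
    simp only [Selector.target]
    ring_nf
  -- At the last step the target is the reward itself: there is no noise, and the excess is exactly
  -- the squared deviation.
  · have h0 : ∀ s, σ.target M h χ ψ s = M.r h s := fun s => by
      simp [Selector.target, brVal_of_le (not_lt.1 hh) χ hψ]
    refine integral_mono (BddMeas.integrable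
      (((BddMeas.const _).mul (R.bddMeas_excess hχ hφ hψ)).exp) _)
      ((hI.comp hev).integrable _) fun ζ => ?_
    simp only [Selector.excess, hh, dif_neg, not_false_iff, h0]
    refine Real.exp_le_exp.2 ?_
    nlinarith [sq_nonneg (φ (ζ h) - M.r h (ζ h))]

/-- Averaging over (x^h, a^h, b^h) as well replaces realised squares by their mean under the
executed policies, the quantity in the decoupling inequality. The price is the drop from 3/50 to
1/25. -/
lemma integral_exp_excess_le (R : Regular F σ) (hχ : χ ∈ stepClass F (h + 1))
    (hφ : φ ∈ stepClass F h) (hψ : ψ ∈ stepClass F (h + 1)) (μ : Policy X A) (ν : Policy X B) :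
    ∫ ζ, Real.exp (-(1 / 10) * σ.excess h χ φ ψ ζ) ∂(episodeLaw M μ ν) ≤
      Real.exp (-(1 / 25) * σ.meanSq h χ φ ψ μ ν) := by
  refine (R.integral_exp_excess_le_integral hχ hφ hψ μ ν).trans ?_
  have hev : Measurable fun ζ : Trajectory M => ζ h := measurable_pi_apply h
  have hs : BddMeas fun ζ : Trajectory M => (φ (ζ h) - σ.target M h χ ψ (ζ h)) ^ 2 :=
    (((R.bddMeas_of_mem hφ).comp hev).sub ((R.bddMeas_target hχ hψ).comp hev)).pow 2
  have hm : ∫ ζ, Real.exp (-(3 / 50) * (φ (ζ h) - σ.target M h χ ψ (ζ h)) ^ 2)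
      ∂(episodeLaw M μ ν) ≤
      ∫ ζ, (1 + -(1 / 25) * (φ (ζ h) - σ.target M h χ ψ (ζ h)) ^ 2) ∂(episodeLaw M μ ν) := by
    refine integral_mono (BddMeas.integrable ((BddMeas.const _).mul hs).exp _)
      (BddMeas.integrable ((BddMeas.const 1).add ((BddMeas.const _).mul hs)) _) fun ζ => ?_
    have h1 := R.abs_sub_target_le hχ hφ hψ (ζ h)
    have h2 : (φ (ζ h) - σ.target M h χ ψ (ζ h)) ^ 2 ≤ 4 := by
      rw [← sq_abs]; nlinarith [abs_nonneg (φ (ζ h) - σ.target M h χ ψ (ζ h))]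
    dsimp only
    generalize (φ (ζ h) - σ.target M h χ ψ (ζ h)) = e at *
    have h3 : |-(3 / 50) * e ^ 2| ≤ 1 := by
      rw [abs_le]; constructor <;> nlinarith [sq_nonneg e]
    -- With e² ≤ 4, the quadratic term (3/50)² e⁴ is at most (36/2500) e², which is less than (3/50
    -- - 1/25) e².
    have h4 := (abs_le.1 (Real.abs_exp_sub_one_sub_id_le h3)).2
    nlinarith [sq_nonneg e]
  refine hm.trans ?_
  rw [integral_add (integrable_const _) (BddMeas.integrable ((BddMeas.const _).mul hs) _),
    integral_const_mul]
  simp only [integral_const, probReal_univ, one_smul]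
  have := Real.add_one_le_exp (-(1 / 25) * σ.meanSq h χ φ ψ μ ν)
  rw [Selector.meanSq] at this ⊢
  linarith

end Regular

end Game

/-! ### Gibbs distributions on finite sets -/

/-- The Gibbs variational principle against a uniform prior. -/
lemma sum_div_mul_neg_log_le {ι : Type*} [Fintype ι] {w : ι → ℝ} (hw : ∀ i, 0 < w i) (j : ι) :
    ∑ i, w i / (∑ k, w k) * -Real.log (w i) ≤ -Real.log (w j) + Real.log (Fintype.card ι) := by
  have hne : (Finset.univ : Finset ι).Nonempty := ⟨j, Finset.mem_univ _⟩
  have hN : (0 : ℝ) < Fintype.card ι := by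
    exact_mod_cast Fintype.card_pos_iff.2 ⟨j⟩
  set W := ∑ k, w k with hW
  have hWpos : 0 < W := Finset.sum_pos (fun i _ => hw i) hne
  have hp : ∑ i, w i / W = 1 := by rw [← Finset.sum_div, div_self hWpos.ne']
  have hj : w j ≤ W := Finset.single_le_sum (f := w) (fun i _ => (hw i).le) (Finset.mem_univ j)
  have hlog : Real.log (w j) ≤ Real.log W := Real.log_le_log (hw j) hj
  -- This is log y ≤ y - 1 at y = W / (N w_i); summed over i, it says that the relative entropy to
  -- the uniform distribution is nonnegative.
  have hi : ∀ i, w i / W * -Real.log (w i) ≤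
      w i / W * (Real.log (Fintype.card ι) - Real.log W) + (1 / Fintype.card ι - w i / W) := by
    intro i
    have h1 := Real.log_le_sub_one_of_pos (x := W / (Fintype.card ι * w i))
      (div_pos hWpos (mul_pos hN (hw i)))
    rw [Real.log_div hWpos.ne' (mul_pos hN (hw i)).ne', Real.log_mul hN.ne' (hw i).ne'] at h1
    have h2 := mul_le_mul_of_nonneg_left h1 (div_pos (hw i) hWpos).le
    have h3 : w i / W * (W / (Fintype.card ι * w i) - 1) = 1 / Fintype.card ι - w i / W := by
      have := (hw i).ne'
      field_simp
    rw [h3] at h2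
    linarith
  refine (Finset.sum_le_sum fun i _ => hi i).trans ?_
  rw [Finset.sum_add_distrib, ← Finset.sum_mul, hp, Finset.sum_sub_distrib, hp]
  simp only [Finset.sum_const, Finset.card_univ, nsmul_eq_mul]
  rw [mul_one_div_cancel hN.ne']
  linarith

/-- The tangent to log at n lies above its graph. This bound is affine in a, so expectations pass
through it without taking the expectation of a logarithm. -/
lemma log_le_log_add_div_sub_one {a n : ℝ} (ha : 0 < a) (hn : 0 < n) :
    Real.log a ≤ Real.log n + a / n - 1 := by
  have := Real.log_le_sub_one_of_pos (div_pos ha hn)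
  rw [Real.log_div ha.ne' hn.ne'] at this
  linarith

lemma BddMeas.of_finite {α : Type*} [MeasurableSpace α] [Finite α] [DiscreteMeasurableSpace α]
    (f : α → ℝ) : BddMeas f := by
  obtain ⟨C, hC⟩ := (Set.finite_range fun x => |f x|).bddAbove
  exact ⟨.of_discrete, C, fun x => hC ⟨x, rfl⟩⟩

section Game

variable {X A B : Type*} [MeasurableSpace X] [MeasurableSpace A] [MeasurableSpace B]
  {M : MarkovGame X A B} {F : FunClass M} {σ : Selector X A B}

instance : DiscreteMeasurableSpace (Mem F) := ⟨fun _ => trivial⟩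

/-! ### The posteriors -/

lemma loss_eq (v : ℕ → X → ℝ) (h : Fin M.H) (φ : X × A × B → ℝ) {t : ℕ}
    (S : Fin t → Trajectory M) :
    loss M v h φ S = ∑ s : Fin t, (φ (S s h) - M.r h (S s h) -
      if hh : (h : ℕ) + 1 < M.H then v (h + 1) (S s ⟨h + 1, hh⟩).1 else 0) ^ 2 := by
  simp [loss]

lemma card_pos_of_mem (f : Mem F) (h : Fin M.H) : (0 : ℝ) < (F h).card := by
  exact_mod_cast Finset.card_pos.2 ⟨_, (f h).2⟩

lemma condProd_pos (η : ℝ) (v : ℕ → X → ℝ) (f : Mem F) {t : ℕ} (S : Fin t → Trajectory M) :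
    0 < condProd η v f S := by
  refine Finset.prod_pos fun h _ => ?_
  have := card_pos_of_mem f h
  exact div_pos (by positivity) (Finset.sum_pos (fun _ _ => by positivity) ⟨_, (f h).2⟩)

/-- The uniform prior cancels between numerator and denominator, leaving only differences of losses;
the noise common to both losses can thus drop out. -/
lemma neg_log_condProd (η : ℝ) (v : ℕ → X → ℝ) (f : Mem F) {t : ℕ}
    (S : Fin t → Trajectory M) :
    -Real.log (condProd η v f S) = ∑ h : Fin M.H, Real.log (∑ φ ∈ F h,
      Real.exp (-η * (loss M v h φ S - loss M v h (f.comp h) S))) := by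
  have hpos : ∀ h : Fin M.H, 0 < ∑ φ ∈ F h, 1 / ((F h).card : ℝ) *
      Real.exp (-η * loss M v h φ S) := fun h => by
    have := card_pos_of_mem f h
    exact Finset.sum_pos (fun _ _ => by positivity) ⟨_, (f h).2⟩
  rw [condProd, Real.log_prod fun h _ => ?_, ← Finset.sum_neg_distrib]
  · refine Finset.sum_congr rfl fun h _ => ?_
    have hc := card_pos_of_mem f h
    rw [← Real.log_inv, inv_div]
    congr 1
    rw [Finset.sum_div]
    refine Finset.sum_congr rfl fun φ _ => ?_
    rw [mul_div_mul_left _ _ (by positivity), ← Real.exp_sub]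
    congr 1
    ring
  · have := card_pos_of_mem f h
    have := hpos h
    positivity

lemma measurable_condProd {η : ℝ} {v : ℕ → X → ℝ} (hv : ∀ h, Measurable (v h))
    (hF : ∀ h : Fin M.H, ∀ φ ∈ F h, Measurable φ) (f : Mem F) (t : ℕ) :
    Measurable fun S : Fin t → Trajectory M => condProd η v f S := by
  have hl : ∀ (h : Fin M.H), ∀ φ ∈ F h,
      Measurable fun S : Fin t → Trajectory M => loss M v h φ S := fun h φ hφ => by
    simp only [loss_eq]
    refine Finset.measurable_fun_sum _ fun s _ => Measurable.pow_const ?_ 2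
    have hev : Measurable fun S : Fin t → Trajectory M => S s h := by fun_prop
    refine (((hF h φ hφ).comp hev).sub ((M.measurable_r h).comp hev)).sub ?_
    split_ifs with hh
    · exact (hv _).comp (by fun_prop)
    · exact measurable_const
  refine Finset.measurable_fun_prod _ fun h _ => ?_
  have hf := hl h _ (f h).2
  rw [← comp_of_lt f h.2] at hf
  exact (measurable_const.mul (measurable_const.mul hf).exp).div
    (Finset.measurable_fun_sum _ fun φ hφ =>
      measurable_const.mul (measurable_const.mul (hl h φ hφ)).exp)

lemma mainWeight_pos (η l : ℝ) {t : ℕ} (S : Fin t → Trajectory M) (f : Mem F) :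
    0 < mainWeight η l S f :=
  mul_pos (Real.exp_pos _) (condProd_pos ..)

lemma boosterWeight_pos (η l : ℝ) (μ : Policy X A) {t : ℕ} (S : Fin t → Trajectory M)
    (g : Mem F) : 0 < boosterWeight η l μ S g :=
  mul_pos (Real.exp_pos _) (condProd_pos ..)

lemma mainPosterior_nonneg (η l : ℝ) {t : ℕ} (S : Fin t → Trajectory M) (f : Mem F) :
    0 ≤ mainPosterior η l S f :=
  div_nonneg (mainWeight_pos ..).le (Finset.sum_nonneg fun _ _ => (mainWeight_pos ..).le)

lemma boosterPosterior_nonneg (η l : ℝ) (μ : Policy X A) {t : ℕ} (S : Fin t → Trajectory M)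
    (f : Mem F) : 0 ≤ boosterPosterior η l μ S f :=
  div_nonneg (boosterWeight_pos ..).le (Finset.sum_nonneg fun _ _ => (boosterWeight_pos ..).le)

lemma sum_mainPosterior [Nonempty (Mem F)] (η l : ℝ) {t : ℕ} (S : Fin t → Trajectory M) :
    ∑ f : Mem F, mainPosterior η l S f = 1 := by
  simp only [mainPosterior, ← Finset.sum_div]
  exact div_self (Finset.sum_pos (fun _ _ => mainWeight_pos ..) Finset.univ_nonempty).ne'

lemma sum_boosterPosterior [Nonempty (Mem F)] (η l : ℝ) (μ : Policy X A) {t : ℕ}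
    (S : Fin t → Trajectory M) : ∑ f : Mem F, boosterPosterior η l μ S f = 1 := by
  simp only [boosterPosterior, ← Finset.sum_div]
  exact div_self (Finset.sum_pos (fun _ _ => boosterWeight_pos ..) Finset.univ_nonempty).ne'

namespace Regular

lemma bddMeas_mainPosterior (R : Regular F σ) (η l : ℝ) (t : ℕ) (f : Mem F) :
    BddMeas fun S : Fin t → Trajectory M => mainPosterior η l S f := by
  have : Nonempty (Mem F) := ⟨f⟩
  have hw : ∀ f : Mem F, Measurable fun S : Fin t → Trajectory M => mainWeight η l S f :=
    fun f => by
      simp only [mainWeight, R.inducedValue_eq]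
      exact measurable_const.mul (measurable_condProd
        (fun h => (R.bddMeas_inducedBrValue f f h).measurable) R.measurable f t)
  refine .of_mem_Icc (a := 0) (b := 1) ((hw f).div (Finset.measurable_fun_sum _ fun f _ => hw f))
    fun S => ⟨mainPosterior_nonneg .., ?_⟩
  rw [← sum_mainPosterior (F := F) η l S]
  exact Finset.single_le_sum (f := fun f => mainPosterior η l S f)
    (fun _ _ => mainPosterior_nonneg ..) (Finset.mem_univ f)

lemma bddMeas_boosterPosterior (R : Regular F σ) (η l : ℝ) (t : ℕ) (f g : Mem F) :
    BddMeas fun S : Fin t → Trajectory M => boosterPosterior η l (σ.maxPolicy f) S g := by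
  have : Nonempty (Mem F) := ⟨f⟩
  have hw : ∀ g : Mem F, Measurable fun S : Fin t → Trajectory M =>
      boosterWeight η l (σ.maxPolicy f) S g :=
    fun g => measurable_const.mul (measurable_condProd
        (fun h => (R.bddMeas_inducedBrValue f g h).measurable) R.measurable g t)
  refine .of_mem_Icc (a := 0) (b := 1) ((hw g).div (Finset.measurable_fun_sum _ fun g _ => hw g))
    fun S => ⟨boosterPosterior_nonneg .., ?_⟩
  rw [← sum_boosterPosterior (F := F) η l (σ.maxPolicy f) S]
  exact Finset.single_le_sum (f := fun g => boosterPosterior η l (σ.maxPolicy f) S g)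
    (fun _ _ => boosterPosterior_nonneg ..) (Finset.mem_univ g)

end Regular

/-! ### Integration along the learning process -/

/-- The law of `(f_{t+1}, g_{t+1})` given the past. -/
noncomputable def sampleProb (σ : Selector X A B) (η l : ℝ) {t : ℕ} (ω : Fin t → Episode F)
    (f g : Mem F) : ℝ :=
  mainPosterior η l (fun s => (ω s).2.2) f *
    boosterPosterior η l (σ.maxPolicy f) (fun s => (ω s).2.2) g

lemma sampleProb_nonneg (η l : ℝ) {t : ℕ} (ω : Fin t → Episode F) (f g : Mem F) :
    0 ≤ sampleProb σ η l ω f g :=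
  mul_nonneg (mainPosterior_nonneg ..) (boosterPosterior_nonneg ..)

lemma sum_sampleProb [Nonempty (Mem F)] (η l : ℝ) {t : ℕ} (ω : Fin t → Episode F) :
    ∑ f : Mem F, ∑ g : Mem F, sampleProb σ η l ω f g = 1 := by
  simp only [sampleProb, ← Finset.mul_sum, sum_boosterPosterior, mul_one, sum_mainPosterior]

lemma Regular.bddMeas_sampleProb (R : Regular F σ) (η l : ℝ) (t : ℕ) (f g : Mem F) :
    BddMeas fun ω : Fin t → Episode F => sampleProb σ η l ω f g :=
  ((R.bddMeas_mainPosterior η l t f).comp (by fun_prop)).mul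
    ((R.bddMeas_boosterPosterior η l t f g).comp (by fun_prop))

lemma measurable_snoc_episode (t : ℕ) (f g : Mem F) :
    Measurable fun p : (Fin t → Episode F) × Trajectory M =>
      (Fin.snoc p.1 ((f, g, p.2) : Episode F) : Fin (t + 1) → Episode F) := by
  refine measurable_pi_iff.2 fun i => ?_
  refine Fin.lastCases ?_ (fun j => ?_) i
  · simp only [Fin.snoc_last]
    fun_prop
  · simp only [Fin.snoc_castSucc]
    fun_prop

lemma processLaw_succ (η l : ℝ) (t : ℕ) :
    processLaw F σ η l (t + 1) = ∑ f : Mem F, ∑ g : Mem F,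
      ((((processLaw F σ η l t).withDensity fun ω =>
          ENNReal.ofReal (sampleProb σ η l ω f g)).prod
        (episodeLaw M (σ.maxPolicy f) (σ.minPolicy f g))).map
          (fun p : (Fin t → Episode F) × Trajectory M =>
            (Fin.snoc p.1 ((f, g, p.2) : Episode F) : Fin (t + 1) → Episode F))) :=
  rfl

lemma Regular.isFiniteMeasure_processLaw (R : Regular F σ) (η l : ℝ) :
    ∀ t, IsFiniteMeasure (processLaw F σ η l t)
  | 0 => by unfold processLaw; infer_instance
  | t + 1 => by
    have := R.isFiniteMeasure_processLaw η l t
    have (f g : Mem F) := isFiniteMeasure_withDensity_ofReal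
      ((R.bddMeas_sampleProb η l t f g).integrable (processLaw F σ η l t)).2
    rw [processLaw_succ]
    infer_instance

/-- The tower property: conditionally on the past, sum over the sampled pair and integrate over the
last trajectory. -/
lemma Regular.integral_processLaw_succ (R : Regular F σ) (η l : ℝ) (t : ℕ)
    {Φ : (Fin (t + 1) → Episode F) → ℝ} (hΦ : BddMeas Φ) :
    ∫ ω, Φ ω ∂(processLaw F σ η l (t + 1)) =
      ∫ ω, ∑ f : Mem F, ∑ g : Mem F, sampleProb σ η l ω f g *
        ∫ ζ, Φ (Fin.snoc ω ((f, g, ζ) : Episode F))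
          ∂(episodeLaw M (σ.maxPolicy f) (σ.minPolicy f g)) ∂(processLaw F σ η l t) := by
  have := R.isFiniteMeasure_processLaw η l t
  have hfin (f g : Mem F) := isFiniteMeasure_withDensity_ofReal
    ((R.bddMeas_sampleProb η l t f g).integrable (processLaw F σ η l t)).2
  have hin (f g : Mem F) : BddMeas fun ω : Fin t → Episode F =>
      ∫ ζ, Φ (Fin.snoc ω ((f, g, ζ) : Episode F))
          ∂(episodeLaw M (σ.maxPolicy f) (σ.minPolicy f g)) :=
    BddMeas.integral_kernel (f := fun p : (Fin t → Episode F) × Trajectory M =>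
      Φ (Fin.snoc p.1 ((f, g, p.2) : Episode F))) (hΦ.comp (measurable_snoc_episode t f g))
      (Kernel.const _ (episodeLaw M (σ.maxPolicy f) (σ.minPolicy f g)))
  have hprod (f g : Mem F) := ((R.bddMeas_sampleProb η l t f g).mul (hin f g)).integrable
    (processLaw F σ η l t)
  rw [processLaw_succ, integral_finsetSum_measure fun f _ => hΦ.integrable _,
    integral_finsetSum _ fun f _ => integrable_finsetSum _ fun g _ => hprod f g]
  refine Finset.sum_congr rfl fun f _ => ?_
  rw [integral_finsetSum_measure fun g _ => hΦ.integrable _,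
    integral_finsetSum _ fun g _ => hprod f g]
  refine Finset.sum_congr rfl fun g _ => ?_
  have hs := measurable_snoc_episode t f g
  rw [integral_map hs.aemeasurable hΦ.measurable.aestronglyMeasurable,
    integral_prod _ ((hΦ.comp hs).integrable _),
    integral_withDensity_eq_integral_toReal_smul
      (R.bddMeas_sampleProb η l t f g).measurable.ennreal_ofReal
      (ae_of_all _ fun _ => ENNReal.ofReal_lt_top)]
  refine integral_congr_ae (ae_of_all _ fun ω => ?_)
  simp only [smul_eq_mul]
  rw [ENNReal.toReal_ofReal (sampleProb_nonneg η l ω f g)]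

lemma Regular.isProbabilityMeasure_processLaw [Nonempty (Mem F)] (R : Regular F σ) (η l : ℝ)
    (t : ℕ) : IsProbabilityMeasure (processLaw F σ η l t) := by
  induction t with
  | zero => unfold processLaw; infer_instance
  | succ t ih =>
    have := R.isFiniteMeasure_processLaw η l (t + 1)
    have h := R.integral_processLaw_succ η l t (BddMeas.const 1)
    simp only [integral_const, probReal_univ, smul_eq_mul, mul_one, sum_sampleProb] at h
    exact (isProbabilityMeasure_iff_real).2 h

end Game

/-- This is how the Gibbs principle is used: G is the quantity to be controlled, a the error in
bounding it by -log w, and j the comparator. -/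
lemma sum_div_mul_le_of_le_neg_log {ι : Type*} [Fintype ι] {w G : ι → ℝ} (hw : ∀ i, 0 < w i)
    {a b : ℝ} (hG : ∀ i, G i ≤ -Real.log (w i) + a) (j : ι) (hj : -Real.log (w j) ≤ b) :
    ∑ i, w i / (∑ k, w k) * G i ≤ a + b + Real.log (Fintype.card ι) := by
  have hW : 0 < ∑ k, w k := Finset.sum_pos (fun i _ => hw i) ⟨j, Finset.mem_univ _⟩
  have h1 : ∑ i, w i / (∑ k, w k) * G i ≤
      ∑ i, (w i / (∑ k, w k) * -Real.log (w i) + w i / (∑ k, w k) * a) :=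
    Finset.sum_le_sum fun i _ => by
      rw [← mul_add]
      exact mul_le_mul_of_nonneg_left (hG i) (div_pos (hw i) hW).le
  rw [Finset.sum_add_distrib, ← Finset.sum_mul, ← Finset.sum_div, div_self hW.ne'] at h1
  linarith [sum_div_mul_neg_log_le hw j]

section Game

variable {X A B : Type*} [MeasurableSpace X] [MeasurableSpace A] [MeasurableSpace B]
  {M : MarkovGame X A B} {F : FunClass M} {σ : Selector X A B}

/-! ### The exponential supermartingale -/

/-- The compensated negative excess loss of one episode. -/
noncomputable def Selector.gain (σ : Selector X A B) {M : MarkovGame X A B} {F : FunClass M}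
    (h : Fin M.H) (χ φ ψ : X × A × B → ℝ) (e : Episode F) : ℝ :=
  -(1 / 10) * σ.excess h χ φ ψ e.2.2 +
    1 / 25 * σ.meanSq h χ φ ψ (σ.maxPolicy e.1) (σ.minPolicy e.1 e.2.1)

/-- The sum of the exponential supermartingales at step `h`. -/
noncomputable def Selector.expGain (σ : Selector X A B) {M : MarkovGame X A B} {F : FunClass M}
    (h : Fin M.H) {t : ℕ} (ω : Fin t → Episode F) : ℝ :=
  ∑ χ ∈ stepClass F (h + 1), ∑ ψ ∈ stepClass F (h + 1), ∑ φ ∈ F h,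
    Real.exp (∑ s, σ.gain h χ φ ψ (ω s))

/-- The number of supermartingales at step `h`. -/
noncomputable def gainCard {M : MarkovGame X A B} (F : FunClass M) (h : Fin M.H) : ℝ :=
  (stepClass F (h + 1)).card * ((stepClass F (h + 1)).card * (F h).card)

/-- A linear upper bound for the logarithm of `expGain`. -/
noncomputable def Selector.pot (σ : Selector X A B) {M : MarkovGame X A B} {F : FunClass M}
    (h : Fin M.H) {t : ℕ} (ω : Fin t → Episode F) : ℝ :=
  Real.log (gainCard F h) + σ.expGain h ω / gainCard F h - 1

lemma stepClass_card_pos (f : Mem F) (h : ℕ) : (0 : ℝ) < (stepClass F h).card := by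
  exact_mod_cast Finset.card_pos.2 ⟨_, comp_mem_stepClass f h⟩

lemma gainCard_pos (f : Mem F) (h : Fin M.H) : 0 < gainCard F h := by
  have := stepClass_card_pos f (h + 1)
  have := card_pos_of_mem f h
  unfold gainCard
  positivity

lemma log_card_mem (f : Mem F) :
    Real.log (Fintype.card (Mem F)) = ∑ h : Fin M.H, Real.log (F h).card := by
  have h1 : Fintype.card (Mem F) = ∏ h : Fin M.H, (F h).card := by
    have : Fintype.card (Mem F) = Fintype.card ((h : Fin M.H) → {φ // φ ∈ F h}) := rfl
    rw [this, Fintype.card_pi]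
    simp
  rw [h1, Nat.cast_prod, Real.log_prod fun h _ => (card_pos_of_mem f h).ne']

/-- Each step contributes log |F_h| once and log |F_{h+1}| twice. Shifting the index costs nothing,
as the class after the last step is a singleton. -/
lemma sum_log_gainCard_le (f : Mem F) :
    ∑ h : Fin M.H, Real.log (gainCard F h) ≤ 3 * Real.log (Fintype.card (Mem F)) := by
  have hlog : ∀ h : Fin M.H, Real.log (gainCard F h) =
      2 * Real.log (stepClass F (h + 1)).card + Real.log (stepClass F h).card := fun h => by
    have h1 := (stepClass_card_pos f (h + 1)).ne'
    have h2 := (card_pos_of_mem f h).ne'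
    rw [gainCard, Real.log_mul h1 (mul_ne_zero h1 h2), Real.log_mul h1 h2, stepClass_fin]
    ring
  have hL : Real.log (Fintype.card (Mem F)) =
      ∑ h ∈ Finset.range M.H, Real.log (stepClass F h).card := by
    rw [Finset.sum_range, log_card_mem f]
    simp only [stepClass_fin]
  have hshift : ∑ h ∈ Finset.range M.H, Real.log (stepClass F (h + 1)).card ≤
      ∑ h ∈ Finset.range M.H, Real.log (stepClass F h).card := by
    have h1 := Finset.sum_range_succ' (fun h => Real.log (stepClass F h).card) M.H
    rw [Finset.sum_range_succ, stepClass_of_le F le_rfl] at h1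
    have h2 : 0 ≤ Real.log (stepClass F 0).card :=
      Real.log_natCast_nonneg _
    simp only [Finset.card_singleton, Nat.cast_one, Real.log_one, add_zero] at h1
    linarith
  simp only [hlog, Finset.sum_add_distrib, ← Finset.mul_sum]
  rw [← Finset.sum_range fun h => Real.log (stepClass F (h + 1)).card,
    ← Finset.sum_range fun h => Real.log (stepClass F h).card, hL]
  linarith

lemma log_expGain_le_pot (f : Mem F) (h : Fin M.H) {t : ℕ} (ω : Fin t → Episode F) :
    Real.log (σ.expGain h ω) ≤ σ.pot h ω :=
  log_le_log_add_div_sub_one (Finset.sum_pos (fun _ _ => Finset.sum_pos (fun _ _ =>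
    Finset.sum_pos (fun _ _ => Real.exp_pos _) ⟨_, (f h).2⟩) ⟨_, comp_mem_stepClass f _⟩)
    ⟨_, comp_mem_stepClass f _⟩) (gainCard_pos f h)

lemma sum_exp_gain_le_expGain {h : Fin M.H} {χ ψ : X × A × B → ℝ}
    (hχ : χ ∈ stepClass F (h + 1)) (hψ : ψ ∈ stepClass F (h + 1)) {t : ℕ}
    (ω : Fin t → Episode F) :
    ∑ φ ∈ F h, Real.exp (∑ s, σ.gain h χ φ ψ (ω s)) ≤ σ.expGain h ω := by
  refine le_trans (Finset.single_le_sum (f := fun ψ => ∑ φ ∈ F h,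
    Real.exp (∑ s, σ.gain h χ φ ψ (ω s))) (fun _ _ => by positivity) hψ) ?_
  exact Finset.single_le_sum (f := fun χ => ∑ ψ ∈ stepClass F (h + 1), ∑ φ ∈ F h,
    Real.exp (∑ s, σ.gain h χ φ ψ (ω s))) (fun _ _ => by positivity) hχ

/-- One exponential is at most the sum of all of them. The bound holds pathwise for every triple, so
χ, φ and ψ may be chosen depending on ω. -/
lemma sum_gain_le_pot {h : Fin M.H} {χ φ ψ : X × A × B → ℝ} (f : Mem F)
    (hχ : χ ∈ stepClass F (h + 1)) (hφ : φ ∈ F h) (hψ : ψ ∈ stepClass F (h + 1)) {t : ℕ}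
    (ω : Fin t → Episode F) : ∑ s, σ.gain h χ φ ψ (ω s) ≤ σ.pot h ω := by
  refine le_trans ?_ (log_expGain_le_pot f h ω)
  rw [← Real.log_exp (∑ s, σ.gain h χ φ ψ (ω s))]
  exact Real.log_le_log (Real.exp_pos _) ((Finset.single_le_sum (f := fun φ =>
    Real.exp (∑ s, σ.gain h χ φ ψ (ω s))) (fun _ _ => (Real.exp_pos _).le) hφ).trans
    (sum_exp_gain_le_expGain hχ hψ ω))

lemma sum_snoc_episode (u : Episode F → ℝ) {t : ℕ} (ω : Fin t → Episode F) (e : Episode F) :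
    ∑ s, u ((Fin.snoc ω e : Fin (t + 1) → Episode F) s) = ∑ s, u (ω s) + u e := by
  simp [Fin.sum_univ_castSucc]

namespace Regular

lemma bddMeas_gain (R : Regular F σ) {h : Fin M.H} {χ φ ψ : X × A × B → ℝ}
    (hχ : χ ∈ stepClass F (h + 1)) (hφ : φ ∈ stepClass F h) (hψ : ψ ∈ stepClass F (h + 1)) :
    BddMeas (σ.gain (F := F) h χ φ ψ) := by
  have h1 : BddMeas fun p : Mem F × Mem F =>
    σ.meanSq h χ φ ψ (σ.maxPolicy p.1) (σ.minPolicy p.1 p.2) := .of_finite _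
  exact ((BddMeas.const _).mul ((R.bddMeas_excess hχ hφ hψ).comp
    (measurable_snd.comp measurable_snd))).add ((BddMeas.const _).mul
      (h1.comp (u := fun e : Episode F => (e.1, e.2.1)) (by fun_prop)))

lemma bddMeas_exp_sum_gain (R : Regular F σ) {h : Fin M.H} {χ φ ψ : X × A × B → ℝ}
    (hχ : χ ∈ stepClass F (h + 1)) (hφ : φ ∈ stepClass F h) (hψ : ψ ∈ stepClass F (h + 1))
    (t : ℕ) : BddMeas fun ω : Fin t → Episode F => Real.exp (∑ s, σ.gain h χ φ ψ (ω s)) :=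
  (BddMeas.sum _ fun s _ => (R.bddMeas_gain hχ hφ hψ).comp (measurable_pi_apply s)).exp

lemma integral_exp_gain_le (R : Regular F σ) {h : Fin M.H} {χ φ ψ : X × A × B → ℝ}
    (hχ : χ ∈ stepClass F (h + 1)) (hφ : φ ∈ stepClass F h) (hψ : ψ ∈ stepClass F (h + 1))
    (f g : Mem F) :
    ∫ ζ, Real.exp (σ.gain h χ φ ψ ((f, g, ζ) : Episode F))
      ∂(episodeLaw M (σ.maxPolicy f) (σ.minPolicy f g)) ≤ 1 := by
  simp only [Selector.gain, Real.exp_add]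
  rw [integral_mul_const]
  refine (mul_le_mul_of_nonneg_right (R.integral_exp_excess_le hχ hφ hψ _ _)
    (Real.exp_pos _).le).trans ?_
  rw [← Real.exp_add]
  simp

/-- The compensator uses the pair sampled in the same episode. Conditionally on the past and that
pair, the new factor has mean at most 1, however the pair was drawn. -/
lemma integral_exp_sum_gain_le (R : Regular F σ) (η l : ℝ) {h : Fin M.H}
    {χ φ ψ : X × A × B → ℝ} (hχ : χ ∈ stepClass F (h + 1)) (hφ : φ ∈ stepClass F h)
    (hψ : ψ ∈ stepClass F (h + 1)) [Nonempty (Mem F)] (t : ℕ) :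
    ∫ ω, Real.exp (∑ s, σ.gain h χ φ ψ (ω s)) ∂(processLaw F σ η l t) ≤ 1 := by
  induction t with
  | zero =>
    have := R.isProbabilityMeasure_processLaw (σ := σ) η l 0
    simp
  | succ t ih =>
    have := R.isProbabilityMeasure_processLaw (σ := σ) η l t
    refine le_trans ?_ ih
    rw [R.integral_processLaw_succ η l t (R.bddMeas_exp_sum_gain hχ hφ hψ (t + 1))]
    simp only [sum_snoc_episode (F := F) (σ.gain h χ φ ψ), Real.exp_add, integral_const_mul]
    have hb := R.bddMeas_exp_sum_gain hχ hφ hψ t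
    refine integral_mono (BddMeas.integrable (BddMeas.sum _ fun f _ => BddMeas.sum _ fun g _ =>
      (R.bddMeas_sampleProb η l t f g).mul (hb.mul (.const _))) _) (hb.integrable _) fun ω => ?_
    have h1 : ∀ f g : Mem F, sampleProb σ η l ω f g * (Real.exp (∑ s, σ.gain h χ φ ψ (ω s)) *
        ∫ ζ, Real.exp (σ.gain h χ φ ψ ((f, g, ζ) : Episode F))
          ∂(episodeLaw M (σ.maxPolicy f) (σ.minPolicy f g))) ≤
        sampleProb σ η l ω f g * Real.exp (∑ s, σ.gain h χ φ ψ (ω s)) := fun f g =>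
      mul_le_mul_of_nonneg_left (mul_le_of_le_one_right (Real.exp_pos _).le
        (R.integral_exp_gain_le hχ hφ hψ f g)) (sampleProb_nonneg ..)
    refine (Finset.sum_le_sum fun f _ => Finset.sum_le_sum fun g _ => h1 f g).trans ?_
    simp only [← Finset.sum_mul, sum_sampleProb, one_mul, le_refl]

lemma bddMeas_expGain (R : Regular F σ) (h : Fin M.H) (t : ℕ) :
    BddMeas fun ω : Fin t → Episode F => σ.expGain h ω :=
  BddMeas.sum _ fun _ hχ => BddMeas.sum _ fun _ hψ => BddMeas.sum _ fun _ hφ =>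
    R.bddMeas_exp_sum_gain hχ (by rwa [stepClass_fin]) hψ t

lemma bddMeas_pot (R : Regular F σ) (h : Fin M.H) (t : ℕ) :
    BddMeas fun ω : Fin t → Episode F => σ.pot h ω := by
  simp only [Selector.pot, div_eq_mul_inv]
  exact ((BddMeas.const _).add ((R.bddMeas_expGain h t).mul (.const _))).sub (.const _)

lemma integral_expGain_le [Nonempty (Mem F)] (R : Regular F σ) (η l : ℝ) (h : Fin M.H) (t : ℕ) :
    ∫ ω, σ.expGain h ω ∂(processLaw F σ η l t) ≤ gainCard F h := by
  have := R.isProbabilityMeasure_processLaw (σ := σ) η l t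
  have hb : ∀ χ ∈ stepClass F (h + 1), ∀ ψ ∈ stepClass F (h + 1), ∀ φ ∈ F h, _ :=
    fun χ hχ ψ hψ φ hφ =>
      R.bddMeas_exp_sum_gain (χ := χ) (φ := φ) (ψ := ψ) hχ (by rwa [stepClass_fin]) hψ t
  have hle : ∀ χ ∈ stepClass F (h + 1), ∀ ψ ∈ stepClass F (h + 1), ∀ φ ∈ F h, _ :=
    fun χ hχ ψ hψ φ hφ => R.integral_exp_sum_gain_le η l (χ := χ) (φ := φ) (ψ := ψ) hχ
      (by rwa [stepClass_fin]) hψ t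
  simp only [Selector.expGain]
  rw [integral_finsetSum _ fun χ hχ => BddMeas.integrable (BddMeas.sum _ fun ψ hψ =>
    BddMeas.sum _ fun φ hφ => hb χ hχ ψ hψ φ hφ) _]
  have : gainCard F h = ∑ χ ∈ stepClass F (h + 1), ∑ ψ ∈ stepClass F (h + 1), ∑ φ ∈ F h,
      (1 : ℝ) := by simp [gainCard]
  rw [this]
  refine Finset.sum_le_sum fun χ hχ => ?_
  rw [integral_finsetSum _ fun ψ hψ => BddMeas.integrable (
    BddMeas.sum _ fun φ hφ => hb χ hχ ψ hψ φ hφ) _]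
  refine Finset.sum_le_sum fun ψ hψ => ?_
  rw [integral_finsetSum _ fun φ hφ => (hb χ hχ ψ hψ φ hφ).integrable _]
  exact Finset.sum_le_sum fun φ hφ => hle χ hχ ψ hψ φ hφ

/-- The mean of `expGain` is at most the number of its summands, so the affine part of `pot`
contributes at most 1 - 1 = 0 beyond the log of that number. -/
lemma integral_sum_pot_le (R : Regular F σ) (η l : ℝ) (f : Mem F) (t : ℕ) :
    ∫ ω, ∑ h, σ.pot h ω ∂(processLaw F σ η l t) ≤ 3 * Real.log (Fintype.card (Mem F)) := by
  have : Nonempty (Mem F) := ⟨f⟩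
  have := R.isProbabilityMeasure_processLaw (σ := σ) η l t
  refine le_trans ?_ (sum_log_gainCard_le f)
  rw [integral_finsetSum _ fun h _ => (R.bddMeas_pot h t).integrable _]
  refine Finset.sum_le_sum fun h _ => ?_
  have hN := gainCard_pos f h
  have hE := (R.bddMeas_expGain h t).integrable (processLaw F σ η l t)
  have hA : Integrable (fun ω => Real.log (gainCard F h) + σ.expGain h ω / gainCard F h)
      (processLaw F σ η l t) := (integrable_const _).add (hE.div_const _)
  simp only [Selector.pot]
  rw [integral_sub hA (integrable_const _),
    integral_add (integrable_const _) (hE.div_const _), integral_div]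
  simp only [integral_const, probReal_univ, one_smul]
  have := (div_le_one hN).2 (R.integral_expGain_le η l h t)
  linarith

end Regular

/-! ### Posterior bounds -/

/-- The mean squared Bellman residual at step `h` in an episode with the sampled functions `p`. -/
noncomputable def Selector.sqResidual (σ : Selector X A B) {M : MarkovGame X A B}
    {F : FunClass M} (h : Fin M.H) (f g : Mem F) (p : Mem F × Mem F) : ℝ :=
  ∫ ζ, (residual (σ.maxPolicy f) g h (ζ h)) ^ 2
    ∂(episodeLaw M (σ.maxPolicy p.1) (σ.minPolicy p.1 p.2))

lemma loss_sub_loss_target (σ : Selector X A B) (f g : Mem F) (h : Fin M.H)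
    (φ : X × A × B → ℝ) {t : ℕ} (S : Fin t → Trajectory M) :
    loss M (inducedBrValue (σ.maxPolicy f) g) h φ S -
      loss M (inducedBrValue (σ.maxPolicy f) g) h (bellman (σ.maxPolicy f) g h) S =
      ∑ s, σ.excess h (f.comp (h + 1)) φ (g.comp (h + 1)) (S s) := by
  rw [loss_eq, loss_eq, ← Finset.sum_sub_distrib]
  rfl

/-- Completeness makes the Bellman image of g a competitor in the normalizing sum. Keeping that
single summand gives η times the excess loss of g, which the potential converts into mean squared
residuals. -/
lemma le_neg_log_condProd (hC : Complete F σ) (f g : Mem F) {t : ℕ} (ω : Fin t → Episode F) :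
    1 / 25 * ∑ h, ∑ s, σ.sqResidual h f g ((ω s).1, (ω s).2.1) - ∑ h, σ.pot h ω ≤
      -Real.log (condProd (1 / 10) (inducedBrValue (σ.maxPolicy f) g) g
        fun s => (ω s).2.2) := by
  rw [neg_log_condProd, Finset.mul_sum, ← Finset.sum_sub_distrib]
  refine Finset.sum_le_sum fun h _ => ?_
  set v := inducedBrValue (σ.maxPolicy f) g
  set S : Fin t → Trajectory M := fun s => (ω s).2.2 with hS
  have hg : g.comp h ∈ F h := by
    simpa only [stepClass_fin] using comp_mem_stepClass g h
  have h1 := sum_gain_le_pot (σ := σ) f (comp_mem_stepClass f (h + 1)) hg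
    (comp_mem_stepClass g (h + 1)) ω
  have h2 : ∑ s, σ.gain h (f.comp (h + 1)) (g.comp h) (g.comp (h + 1)) (ω s) =
      -(1 / 10) * ∑ s, σ.excess h (f.comp (h + 1)) (g.comp h) (g.comp (h + 1)) (S s) +
        1 / 25 * ∑ s, σ.sqResidual h f g ((ω s).1, (ω s).2.1) := by
    rw [Finset.mul_sum, Finset.mul_sum, ← Finset.sum_add_distrib]
    rfl
  have h3 := Finset.single_le_sum (f := fun φ => Real.exp (-(1 / 10) *
    (loss M v h φ S - loss M v h (g.comp h) S))) (fun _ _ => (Real.exp_pos _).le) (hC f g h)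
  have h4 := Real.log_le_log (Real.exp_pos _) h3
  rw [Real.log_exp] at h4
  have h5 := loss_sub_loss_target σ f g h (g.comp h) S
  linarith

/-- A function without residuals is its own regression target, so each exponent is -η times an
excess loss; adding the nonnegative compensators gives a part of `expGain`. -/
lemma neg_log_condProd_le (f g : Mem F)
    (h0 : ∀ h < M.H, ∀ s, residual (σ.maxPolicy f) g h s = 0) {t : ℕ} (ω : Fin t → Episode F) :
    -Real.log (condProd (1 / 10) (inducedBrValue (σ.maxPolicy f) g) g fun s => (ω s).2.2) ≤
      ∑ h, σ.pot h ω := by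
  rw [neg_log_condProd]
  refine Finset.sum_le_sum fun h _ => ?_
  have hg : g.comp h = bellman (σ.maxPolicy f) g h := by
    ext s
    exact sub_eq_zero.1 (h0 h h.2 s)
  have hne : (F h).Nonempty := ⟨_, (g h).2⟩
  refine le_trans (Real.log_le_log (Finset.sum_pos (fun _ _ => Real.exp_pos _) hne) ?_)
    (log_expGain_le_pot f h ω)
  refine le_trans (Finset.sum_le_sum fun φ _ => ?_)
    (sum_exp_gain_le_expGain (comp_mem_stepClass f (h + 1)) (comp_mem_stepClass g (h + 1)) ω)
  rw [hg, loss_sub_loss_target, Finset.mul_sum]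
  refine Real.exp_le_exp.2 (Finset.sum_le_sum fun s _ => ?_)
  have : 0 ≤ σ.meanSq h (f.comp (h + 1)) φ (g.comp (h + 1)) (σ.maxPolicy (ω s).1)
      (σ.minPolicy (ω s).1 (ω s).2.1) := integral_nonneg fun _ => sq_nonneg _
  rw [Selector.gain]
  linarith

/-- One potential comes from the lower bound on -log(weight), the other from the comparator. -/
lemma sum_mainPosterior_mul_le (R : Regular F σ) (hC : Complete F σ) (l : ℝ) {vs : ℝ}
    {fs : Mem F} (hV : inducedBrValue (σ.maxPolicy fs) fs 0 M.x₁ = vs)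
    (h0 : ∀ h < M.H, ∀ s, residual (σ.maxPolicy fs) fs h s = 0) {t : ℕ}
    (ω : Fin t → Episode F) :
    ∑ f : Mem F, mainPosterior (1 / 10) l (fun s => (ω s).2.2) f *
      (l * (vs - inducedBrValue (σ.maxPolicy f) f 0 M.x₁) +
        1 / 25 * ∑ h, ∑ s, σ.sqResidual h f f ((ω s).1, (ω s).2.1)) ≤
      2 * ∑ h, σ.pot h ω + Real.log (Fintype.card (Mem F)) := by
  have hlog : ∀ f : Mem F, -Real.log (mainWeight (1 / 10) l (fun s => (ω s).2.2) f) =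
      -(l * inducedBrValue (σ.maxPolicy f) f 0 M.x₁) - Real.log (condProd (1 / 10)
        (inducedBrValue (σ.maxPolicy f) f) f fun s => (ω s).2.2) := fun f => by
    rw [mainWeight, Real.log_mul (Real.exp_pos _).ne' (condProd_pos ..).ne', Real.log_exp,
      R.inducedValue_eq]
    ring
  refine (sum_div_mul_le_of_le_neg_log (a := l * vs + ∑ h, σ.pot h ω)
    (b := -(l * vs) + ∑ h, σ.pot h ω) (fun f => mainWeight_pos ..) (fun f => ?_) fs ?_).trans
    (le_of_eq (by ring))
  · rw [hlog]
    linarith [le_neg_log_condProd hC f f ω]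
  · rw [hlog, hV]
    linarith [neg_log_condProd_le fs fs h0 ω]

/-- The comparator g' depends on the sampled f, which is harmless because the potential bounds are
pathwise and uniform in f. -/
lemma sum_boosterPosterior_mul_le (hC : Complete F σ) (l : ℝ) {v : ℝ}
    {f g' : Mem F} (hV : inducedBrValue (σ.maxPolicy f) g' 0 M.x₁ = v)
    (h0 : ∀ h < M.H, ∀ s, residual (σ.maxPolicy f) g' h s = 0) {t : ℕ}
    (ω : Fin t → Episode F) :
    ∑ g : Mem F, boosterPosterior (1 / 10) l (σ.maxPolicy f) (fun s => (ω s).2.2) g *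
      (l * (inducedBrValue (σ.maxPolicy f) g 0 M.x₁ - v) +
        1 / 25 * ∑ h, ∑ s, σ.sqResidual h f g ((ω s).1, (ω s).2.1)) ≤
      2 * ∑ h, σ.pot h ω + Real.log (Fintype.card (Mem F)) := by
  have hlog : ∀ g : Mem F,
      -Real.log (boosterWeight (1 / 10) l (σ.maxPolicy f) (fun s => (ω s).2.2) g) =
      l * inducedBrValue (σ.maxPolicy f) g 0 M.x₁ - Real.log (condProd (1 / 10)
        (inducedBrValue (σ.maxPolicy f) g) g fun s => (ω s).2.2) := fun g => by
    rw [boosterWeight, Real.log_mul (Real.exp_pos _).ne' (condProd_pos ..).ne', Real.log_exp]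
    ring
  refine (sum_div_mul_le_of_le_neg_log (a := -(l * v) + ∑ h, σ.pot h ω)
    (b := l * v + ∑ h, σ.pot h ω) (fun f => boosterWeight_pos ..) (fun g => ?_) g' ?_).trans
    (le_of_eq (by ring))
  · rw [hlog]
    linarith [le_neg_log_condProd hC f g ω]
  · rw [hlog, hV]
    linarith [neg_log_condProd_le f g' h0 ω]

end Game

section Game

variable {X A B : Type*} [MeasurableSpace X] [MeasurableSpace A] [MeasurableSpace B]
  {M : MarkovGame X A B} {F : FunClass M} {σ : Selector X A B}

/-! ### Expected potentials along the learning process -/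

/-- Value gaps and in-sample squared residuals of the functions `f`, `g`, given the functions `q`
that were sampled in the past. -/
noncomputable def Selector.roundPot (σ : Selector X A B) {M : MarkovGame X A B} {F : FunClass M}
    (l vs : ℝ) (f g : Mem F) {t : ℕ} (q : Fin t → Mem F × Mem F) : ℝ :=
  (l * (vs - inducedBrValue (σ.maxPolicy f) f 0 M.x₁) +
      1 / 25 * ∑ h, ∑ s, σ.sqResidual h f f (q s)) +
    (l * (inducedBrValue (σ.maxPolicy f) g 0 M.x₁ - brValue M (σ.maxPolicy f) 0 M.x₁) +
      1 / 25 * ∑ h, ∑ s, σ.sqResidual h f g (q s))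

/-- The potentials of the first `T` rounds. -/
noncomputable def Selector.totalPot (σ : Selector X A B) {M : MarkovGame X A B} {F : FunClass M}
    (l vs : ℝ) (T : ℕ) (p : ℕ → Mem F × Mem F) : ℝ :=
  ∑ t ∈ Finset.range T, σ.roundPot l vs (p t).1 (p t).2 fun s : Fin t => p s

/-- The sampled functions of the first `t` rounds, continued by `p₀`. -/
def sampledPairs (p₀ : Mem F × Mem F) {t : ℕ} (ω : Fin t → Episode F) (s : ℕ) : Mem F × Mem F :=
  if hs : s < t then ((ω ⟨s, hs⟩).1, (ω ⟨s, hs⟩).2.1) else p₀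

lemma sampledPairs_fin (p₀ : Mem F × Mem F) {t : ℕ} (ω : Fin t → Episode F) (s : Fin t) :
    sampledPairs p₀ ω s = ((ω s).1, (ω s).2.1) := by
  simp [sampledPairs]

lemma sampledPairs_snoc_of_lt (p₀ : Mem F × Mem F) {t : ℕ} (ω : Fin t → Episode F)
    (e : Episode F) {s : ℕ} (hs : s < t) :
    sampledPairs p₀ (Fin.snoc ω e : Fin (t + 1) → Episode F) s = sampledPairs p₀ ω s := by
  simp [sampledPairs, Fin.snoc, hs, Nat.lt_succ_of_lt hs]

lemma sampledPairs_snoc_self (p₀ : Mem F × Mem F) {t : ℕ} (ω : Fin t → Episode F)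
    (e : Episode F) :
    sampledPairs p₀ (Fin.snoc ω e : Fin (t + 1) → Episode F) t = (e.1, e.2.1) := by
  simp [sampledPairs, Fin.snoc]

lemma measurable_sampledPairs (p₀ : Mem F × Mem F) (t s : ℕ) :
    Measurable fun ω : Fin t → Episode F => sampledPairs p₀ ω s := by
  unfold sampledPairs
  split_ifs with hs <;> fun_prop

lemma totalPot_snoc (l vs : ℝ) (p₀ : Mem F × Mem F) {t : ℕ} (ω : Fin t → Episode F)
    (e : Episode F) :
    σ.totalPot l vs (t + 1) (sampledPairs p₀ (Fin.snoc ω e : Fin (t + 1) → Episode F)) =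
      σ.totalPot l vs t (sampledPairs p₀ ω) +
        σ.roundPot l vs e.1 e.2.1 fun s => ((ω s).1, (ω s).2.1) := by
  rw [Selector.totalPot, Finset.sum_range_succ, sampledPairs_snoc_self]
  congr 1
  · refine Finset.sum_congr rfl fun k hk => ?_
    have hk' := Finset.mem_range.1 hk
    rw [sampledPairs_snoc_of_lt _ _ _ hk']
    congr 1; ext1 s
    exact sampledPairs_snoc_of_lt _ _ _ (s.2.trans hk')
  · congr 1; ext1 s
    rw [sampledPairs_snoc_of_lt _ _ _ s.2, sampledPairs_fin]

lemma bddMeas_roundPot {α : Type*} [MeasurableSpace α] (l vs : ℝ) {t : ℕ} {u : α → Mem F × Mem F}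
    (hu : Measurable u) {q : Fin t → α → Mem F × Mem F} (hq : ∀ s, Measurable (q s)) :
    BddMeas fun ω => σ.roundPot l vs (u ω).1 (u ω).2 fun s => q s ω := by
  have h2 (G : Mem F × Mem F → ℝ) : BddMeas fun ω => G (u ω) := (BddMeas.of_finite G).comp hu
  have h4 (G : (Mem F × Mem F) × (Mem F × Mem F) → ℝ) (s : Fin t) :
      BddMeas fun ω => G (u ω, q s ω) := (BddMeas.of_finite G).comp (hu.prodMk (hq s))
  unfold Selector.roundPot
  exact ((h2 fun p => l * (vs - inducedBrValue (σ.maxPolicy p.1) p.1 0 M.x₁)).add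
    ((BddMeas.const _).mul (.sum _ fun h _ => .sum _ fun s _ =>
      h4 (fun p => σ.sqResidual h p.1.1 p.1.1 p.2) s))).add
    ((h2 fun p => l * (inducedBrValue (σ.maxPolicy p.1) p.2 0 M.x₁ -
      brValue M (σ.maxPolicy p.1) 0 M.x₁)).add ((BddMeas.const _).mul
        (.sum _ fun h _ => .sum _ fun s _ => h4 (fun p => σ.sqResidual h p.1.1 p.1.2 p.2) s)))

lemma bddMeas_totalPot (l vs : ℝ) (p₀ : Mem F × Mem F) (t T : ℕ) :
    BddMeas fun ω : Fin t → Episode F => σ.totalPot l vs T (sampledPairs p₀ ω) :=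
  BddMeas.sum _ fun k _ => bddMeas_roundPot l vs (measurable_sampledPairs p₀ t k)
    (q := fun (s : Fin k) (ω : Fin t → Episode F) => sampledPairs p₀ ω s)
    fun s => measurable_sampledPairs p₀ t s

lemma sum_sampleProb_mul_roundPot_le (R : Regular F σ) (hC : Complete F σ) (l : ℝ) {vs : ℝ}
    {fs : Mem F} (hV : inducedBrValue (σ.maxPolicy fs) fs 0 M.x₁ = vs)
    (h0 : ∀ h < M.H, ∀ s, residual (σ.maxPolicy fs) fs h s = 0)
    (hbr : ∀ f : Mem F, ∀ h : Fin M.H, brQValue M (σ.maxPolicy f) h ∈ F h) {t : ℕ}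
    (ω : Fin t → Episode F) :
    ∑ f : Mem F, ∑ g : Mem F, sampleProb σ (1 / 10) l ω f g *
      σ.roundPot l vs f g (fun s => ((ω s).1, (ω s).2.1)) ≤
      4 * ∑ h, σ.pot h ω + 2 * Real.log (Fintype.card (Mem F)) := by
  have : Nonempty (Mem F) := ⟨fs⟩
  have hmain := sum_mainPosterior_mul_le R hC l hV h0 ω
  have hf : ∀ f : Mem F, ∑ g : Mem F, sampleProb σ (1 / 10) l ω f g *
      σ.roundPot l vs f g (fun s => ((ω s).1, (ω s).2.1)) ≤
      mainPosterior (1 / 10) l (fun s => (ω s).2.2) f *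
        (l * (vs - inducedBrValue (σ.maxPolicy f) f 0 M.x₁) +
          1 / 25 * ∑ h, ∑ s, σ.sqResidual h f f ((ω s).1, (ω s).2.1)) +
      mainPosterior (1 / 10) l (fun s => (ω s).2.2) f *
        (2 * ∑ h, σ.pot h ω + Real.log (Fintype.card (Mem F))) := by
    intro f
    obtain ⟨g', hg', hr⟩ := exists_mem_brValue R f (hbr f)
    have hb := sum_boosterPosterior_mul_le hC l hg' hr ω
    simp only [sampleProb, mul_assoc, ← Finset.mul_sum]
    rw [← mul_add]
    refine mul_le_mul_of_nonneg_left ?_ (mainPosterior_nonneg ..)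
    simp only [Selector.roundPot, mul_add _ (l * (vs - _) + _), Finset.sum_add_distrib,
      ← Finset.sum_mul, sum_boosterPosterior, one_mul]
    exact add_le_add le_rfl hb
  refine (Finset.sum_le_sum fun f _ => hf f).trans ?_
  rw [Finset.sum_add_distrib, ← Finset.sum_mul, sum_mainPosterior]
  linarith

/-- Each round adds at most 4 potentials, of total mean at most 4 · 3 log |F|, and 2 log |F| from
the two Gibbs bounds. -/
lemma integral_totalPot_le (R : Regular F σ) (hC : Complete F σ) (l : ℝ) {vs : ℝ}
    {fs : Mem F} (hV : inducedBrValue (σ.maxPolicy fs) fs 0 M.x₁ = vs)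
    (h0 : ∀ h < M.H, ∀ s, residual (σ.maxPolicy fs) fs h s = 0)
    (hbr : ∀ f : Mem F, ∀ h : Fin M.H, brQValue M (σ.maxPolicy f) h ∈ F h)
    (p₀ : Mem F × Mem F) (T : ℕ) :
    ∫ ω, σ.totalPot l vs T (sampledPairs p₀ ω) ∂(processLaw F σ (1 / 10) l T) ≤
      T * (14 * Real.log (Fintype.card (Mem F))) := by
  have : Nonempty (Mem F) := ⟨fs⟩
  induction T with
  | zero => simp [Selector.totalPot]
  | succ T ih =>
    have := R.isProbabilityMeasure_processLaw (σ := σ) (1 / 10) l T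
    rw [R.integral_processLaw_succ _ l T (bddMeas_totalPot l vs p₀ (T + 1) (T + 1))]
    have hS := bddMeas_totalPot (σ := σ) l vs p₀ T T
    have hq : ∀ s : Fin T, Measurable fun ω : Fin T → Episode F => ((ω s).1, (ω s).2.1) :=
      fun s => by fun_prop
    have hP : BddMeas fun ω : Fin T → Episode F => ∑ f : Mem F, ∑ g : Mem F,
        sampleProb σ (1 / 10) l ω f g *
          σ.roundPot l vs f g (fun s => ((ω s).1, (ω s).2.1)) :=
      .sum _ fun f _ => .sum _ fun g _ => (R.bddMeas_sampleProb _ l T f g).mul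
        (bddMeas_roundPot l vs (u := fun _ => (f, g)) measurable_const hq)
    have heq : ∀ ω : Fin T → Episode F, ∑ f : Mem F, ∑ g : Mem F,
        sampleProb σ (1 / 10) l ω f g * ∫ ζ, σ.totalPot l vs (T + 1) (sampledPairs p₀
          (Fin.snoc ω ((f, g, ζ) : Episode F) : Fin (T + 1) → Episode F))
            ∂(episodeLaw M (σ.maxPolicy f) (σ.minPolicy f g)) =
        σ.totalPot l vs T (sampledPairs p₀ ω) + ∑ f : Mem F, ∑ g : Mem F,
          sampleProb σ (1 / 10) l ω f g *
            σ.roundPot l vs f g (fun s => ((ω s).1, (ω s).2.1)) := fun ω => by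
      simp only [totalPot_snoc, integral_const, probReal_univ, one_smul, mul_add,
        Finset.sum_add_distrib, ← Finset.sum_mul, sum_sampleProb, one_mul]
    simp only [heq]
    rw [integral_add (hS.integrable _) (hP.integrable _)]
    have hpot : BddMeas fun ω : Fin T → Episode F => ∑ h, σ.pot h ω :=
      .sum _ fun h _ => R.bddMeas_pot h T
    have h1 := integral_mono (hP.integrable (processLaw F σ (1 / 10) l T))
      (BddMeas.integrable (((BddMeas.const 4).mul hpot).add (.const
        (2 * Real.log (Fintype.card (Mem F))))) _)
      fun ω => sum_sampleProb_mul_roundPot_le R hC l hV h0 hbr ω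
    rw [integral_add (((BddMeas.const 4).mul hpot).integrable _) (integrable_const _),
      integral_const_mul] at h1
    simp only [integral_const, probReal_univ, one_smul] at h1
    have h2 := R.integral_sum_pot_le (1 / 10) l fs T
    push_cast
    linarith

/-! ### Regret along a sequence of sampled functions -/

lemma Regular.abs_residual_le (R : Regular F σ) (f g : Mem F) (h : Fin M.H) (s : X × A × B) :
    |residual (σ.maxPolicy f) g h s| ≤ 2 :=
  R.abs_sub_target_le (comp_mem_stepClass f (h + 1)) (comp_mem_stepClass g h)
    (comp_mem_stepClass g (h + 1)) s

/-- Residuals are bounded by 2, so some integer is admissible. Without this, `sInf` over the empty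
set would be 0 and the inequality at `dc` could fail. -/
lemma Regular.exists_decouplingIneq (R : Regular F σ) (T : ℕ) {m : ℝ} (hm : 0 < m) :
    ∃ K : ℕ, ∀ f g e : ℕ → Mem F, DecouplingIneq σ T m K f g e := by
  obtain ⟨K, hK⟩ := exists_nat_ge (4 * m * (M.H * (T * 2)))
  refine ⟨K, fun f g e => ?_⟩
  have h1 : |∑ h : Fin M.H, ∑ t ∈ Finset.range T,
      ∫ ζ, residual (σ.maxPolicy (f t)) (e t) h (ζ h)
        ∂(episodeLaw M (σ.maxPolicy (f t)) (σ.minPolicy (f t) (g t)))| ≤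
      ∑ h : Fin M.H, ∑ t ∈ Finset.range T, (2 : ℝ) := by
    refine (Finset.abs_sum_le_sum_abs _ _).trans (Finset.sum_le_sum fun h _ =>
      (Finset.abs_sum_le_sum_abs _ _).trans (Finset.sum_le_sum fun t _ => ?_))
    simpa using norm_integral_le_of_norm_le_const
      (μ := episodeLaw M (σ.maxPolicy (f t)) (σ.minPolicy (f t) (g t))) (C := 2)
      (f := fun ζ => residual (σ.maxPolicy (f t)) (e t) h (ζ h))
      (ae_of_all _ fun ζ => R.abs_residual_le (f t) (e t) h (ζ h))
  simp only [Finset.sum_const, Finset.card_univ, Fintype.card_fin, Finset.card_range,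
    nsmul_eq_mul] at h1
  refine h1.trans (le_add_of_nonneg_of_le ?_ ?_)
  · exact mul_nonneg hm.le (Finset.sum_nonneg fun _ _ => Finset.sum_nonneg fun _ _ =>
      Finset.sum_nonneg fun _ _ => integral_nonneg fun _ => sq_nonneg _)
  · rw [le_div_iff₀ (by positivity)]
    linarith

lemma Regular.decouplingIneq_dc (R : Regular F σ) (T : ℕ) {m : ℝ} (hm : 0 < m)
    (f g : ℕ → Mem F) :
    DecouplingIneq σ T m (dc F σ T m) f g f ∧ DecouplingIneq σ T m (dc F σ T m) f g g := by
  obtain ⟨K, hK⟩ := R.exists_decouplingIneq T hm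
  exact Nat.sInf_mem (s := {K : ℕ | ∀ f g : ℕ → Mem F,
    DecouplingIneq σ T m K f g f ∧ DecouplingIneq σ T m K f g g})
    ⟨K, fun f g => ⟨hK f g f, hK f g g⟩⟩ f g

lemma Regular.regret_le_totalPot (R : Regular F σ) (T : ℕ) {l D : ℝ} (vs : ℝ) (hl : 1 / 25 ≤ l)
    (hD : ∀ m : ℝ, 0 < m → m ≤ 1 → (dc F σ T m : ℝ) ≤ D) (p : ℕ → Mem F × Mem F) :
    ∑ t ∈ Finset.range T, (vs - brValue M (σ.maxPolicy (p t).1) 0 M.x₁) ≤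
      σ.totalPot l vs T p / l + 25 / 2 * (l * D) := by
  have hl0 : 0 < l := by linarith
  -- With this m, the squares in the decoupling bound carry the weight they have in the potential
  -- divided by l, and K / (4m) = 25 l K / 4. Two uses, for f and for g, give the constant 25/2.
  set m : ℝ := 1 / 25 / l with hm
  have hm0 : 0 < m := by positivity
  have hm1 : m ≤ 1 := (div_le_one hl0).2 hl
  obtain ⟨hf, hg⟩ := R.decouplingIneq_dc T hm0 (fun t => (p t).1) (fun t => (p t).2)
  have hK : (dc F σ T m : ℝ) / (4 * m) ≤ 25 / 4 * (l * D) := by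
    rw [hm, show (4 * (1 / 25 / l) : ℝ) = 4 / (25 * l) by field_simp, div_div_eq_mul_div,
      div_le_iff₀ (by norm_num)]
    nlinarith [hD m hm0 hm1]
  let a (t : ℕ) (e : Mem F) (h : Fin M.H) : ℝ :=
    ∫ ζ, residual (σ.maxPolicy (p t).1) e h (ζ h)
      ∂(episodeLaw M (σ.maxPolicy (p t).1) (σ.minPolicy (p t).1 (p t).2))
  have h1 : ∑ t ∈ Finset.range T, ∑ h, a t (p t).1 h ≤
      m * ∑ h : Fin M.H, ∑ t ∈ Finset.range T, ∑ s ∈ Finset.range t,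
        σ.sqResidual h (p t).1 (p t).1 (p s) + (dc F σ T m : ℝ) / (4 * m) :=
    Finset.sum_comm.trans_le ((le_abs_self _).trans hf)
  have h2 : -∑ t ∈ Finset.range T, ∑ h, a t (p t).2 h ≤
      m * ∑ h : Fin M.H, ∑ t ∈ Finset.range T, ∑ s ∈ Finset.range t,
        σ.sqResidual h (p t).1 (p t).2 (p s) + (dc F σ T m : ℝ) / (4 * m) :=
    (congrArg Neg.neg Finset.sum_comm).trans_le ((neg_le_abs _).trans hg)
  -- The value of the executed pair is inserted between the two induced values and cancels between
  -- the two one-sided decompositions.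
  have hstep : ∀ t, vs - brValue M (σ.maxPolicy (p t).1) 0 M.x₁ ≤
      (vs - inducedBrValue (σ.maxPolicy (p t).1) (p t).1 0 M.x₁) +
      (inducedBrValue (σ.maxPolicy (p t).1) (p t).2 0 M.x₁ -
        brValue M (σ.maxPolicy (p t).1) 0 M.x₁) +
      (∑ h, a t (p t).1 h - ∑ h, a t (p t).2 h) := fun t => by
    have h3 := R.inducedBrValue_sub_value_le (p t).1 (p t).1 (σ.minPolicy (p t).1 (p t).2)
    have h4 := R.le_inducedBrValue_sub_value (p t).1 (p t).2
    linarith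
  have hpot : σ.totalPot l vs T p / l = ∑ t ∈ Finset.range T,
      ((vs - inducedBrValue (σ.maxPolicy (p t).1) (p t).1 0 M.x₁) +
      (inducedBrValue (σ.maxPolicy (p t).1) (p t).2 0 M.x₁ -
        brValue M (σ.maxPolicy (p t).1) 0 M.x₁)) +
      m * ∑ h : Fin M.H, ∑ t ∈ Finset.range T, ∑ s ∈ Finset.range t,
        σ.sqResidual h (p t).1 (p t).1 (p s) +
      m * ∑ h : Fin M.H, ∑ t ∈ Finset.range T, ∑ s ∈ Finset.range t,
        σ.sqResidual h (p t).1 (p t).2 (p s) := by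
    rw [Finset.sum_comm (s := Finset.univ), Finset.sum_comm (s := Finset.univ), Finset.mul_sum,
      Finset.mul_sum, ← Finset.sum_add_distrib, ← Finset.sum_add_distrib, Selector.totalPot,
      Finset.sum_div]
    refine Finset.sum_congr rfl fun t _ => ?_
    simp only [Selector.roundPot, Finset.sum_range]
    rw [hm]
    field_simp
    ring
  have hsum := Finset.sum_le_sum fun t (_ : t ∈ Finset.range T) => hstep t
  rw [Finset.sum_add_distrib (g := fun t => ∑ h, a t (p t).1 h - ∑ h, a t (p t).2 h),
    Finset.sum_sub_distrib (fun t => ∑ h, a t (p t).1 h)] at hsum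
  linarith

lemma Regular.integral_sum_regret_le (R : Regular F σ) (hC : Complete F σ) {l D vs : ℝ}
    {fs : Mem F} (hV : inducedBrValue (σ.maxPolicy fs) fs 0 M.x₁ = vs)
    (h0 : ∀ h < M.H, ∀ s, residual (σ.maxPolicy fs) fs h s = 0)
    (hbr : ∀ f : Mem F, ∀ h : Fin M.H, brQValue M (σ.maxPolicy f) h ∈ F h) (T : ℕ)
    (hl : 1 / 25 ≤ l) (hD : ∀ m : ℝ, 0 < m → m ≤ 1 → (dc F σ T m : ℝ) ≤ D) :
    ∫ ω, ∑ t : Fin T, (vs - brValue M (σ.maxPolicy (ω t).1) 0 M.x₁)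
      ∂(processLaw F σ (1 / 10) l T) ≤
      T * (14 * Real.log (Fintype.card (Mem F))) / l + 25 / 2 * (l * D) := by
  have : Nonempty (Mem F) := ⟨fs⟩
  have := R.isProbabilityMeasure_processLaw (σ := σ) (1 / 10) l T
  have hl0 : 0 < l := by linarith
  have hT := (bddMeas_totalPot (σ := σ) l vs (fs, fs) T T).integrable
    (processLaw F σ (1 / 10) l T)
  have hreg : BddMeas fun ω : Fin T → Episode F =>
      ∑ t : Fin T, (vs - brValue M (σ.maxPolicy (ω t).1) 0 M.x₁) :=
    .sum _ fun t _ => (BddMeas.of_finite fun f : Mem F =>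
      vs - brValue M (σ.maxPolicy f) 0 M.x₁).comp (by fun_prop)
  refine (integral_mono (hreg.integrable _) ((hT.div_const l).add (integrable_const _))
    fun ω => ?_).trans (b := ∫ ω, (σ.totalPot l vs T (sampledPairs (fs, fs) ω) / l +
      25 / 2 * (l * D)) ∂(processLaw F σ (1 / 10) l T)) ?_
  · have h1 := R.regret_le_totalPot T vs hl hD (sampledPairs (fs, fs) ω)
    rw [Finset.sum_range] at h1
    simp only [sampledPairs_fin] at h1
    exact h1
  · rw [integral_add (hT.div_const l) (integrable_const _), integral_div]
    simp only [integral_const, probReal_univ, one_smul]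
    have := integral_totalPot_le R hC l hV h0 hbr (fs, fs) T
    gcongr

end Game

end ZeroSumMG

/-! ### Choice of the optimism parameter and the regret bound -/

theorem mainTheorem5 :
    ∃ C : ℝ, 0 < C ∧
      ∀ (X : Type*) (A : Type*) (B : Type*) [MeasurableSpace X] [MeasurableSpace A]
        [MeasurableSpace B] (M : MarkovGame X A B) (F : FunClass M) (σ : Selector X A B)
        (μs : Policy X A) (νs : Policy X B) (T : ℕ) (D : ℝ),
        IsNash M μs νs →
        σ.IsOptimal F →
        (∀ h : Fin M.H, ∀ φ ∈ F h, Measurable φ) →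
        Realizable F σ μs νs →
        Complete F σ →
        BoundedBy F 2 →
        0 < D →
        (∀ m : ℝ, 0 < m → m ≤ 1 → (dc F σ T m : ℝ) ≤ D) →
        expectedRegret F σ μs νs (1 / 10)
            (Real.sqrt (T * Real.log (Fintype.card (Mem F)) / D)) T ≤
          C * Real.sqrt (D * T * Real.log (Fintype.card (Mem F))) := by
  -- 53/2 = 14 + 25/2, since T L / l = l D = √(D T L) when l > 0.
  refine ⟨53 / 2, by norm_num, ?_⟩
  intro X A B _ _ _ M F σ μs νs T D hN hopt hmeas hreal hC hbdd hD hdc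
  have R : Regular F σ := ⟨hopt, hmeas, hbdd⟩
  obtain ⟨fs, hV, h0⟩ := exists_mem_nashValue R hN fun h => (hreal h).1
  have hbr : ∀ f : Mem F, ∀ h : Fin M.H, brQValue M (σ.maxPolicy f) h ∈ F h :=
    fun f h => (hreal h).2 f
  have : Nonempty (Mem F) := ⟨fs⟩
  set L := Real.log (Fintype.card (Mem F)) with hL
  set l := Real.sqrt (T * L / D) with hl
  have := R.isProbabilityMeasure_processLaw (σ := σ) (1 / 10) l T
  have hL0 : 0 ≤ L := Real.log_natCast_nonneg _
  have hl2 : l ^ 2 * D = T * L := by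
    rw [hl, Real.sq_sqrt (by positivity)]
    field_simp
  have hlD : Real.sqrt (D * T * L) = l * D := by
    rw [show D * T * L = (l * D) ^ 2 by rw [mul_assoc, ← hl2]; ring]
    exact Real.sqrt_sq (by positivity)
  rw [hlD, expectedRegret]
  -- The decoupling bound is available only for m = 1/(25 l) ≤ 1. The other branch includes l = 0.
  rcases le_or_gt (1 / 25) l with hbig | hsmall
  · refine (R.integral_sum_regret_le hC hV h0 hbr T hbig hdc).trans (le_of_eq ?_)
    rw [show (T * (14 * L) : ℝ) = 14 * (l ^ 2 * D) by rw [hl2]; ring]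
    field_simp
    ring
  · have hreg : BddMeas fun ω : Fin T → Episode F =>
        ∑ t : Fin T, (value M μs νs 0 M.x₁ - brValue M (σ.maxPolicy (ω t).1) 0 M.x₁) :=
      .sum _ fun t _ => (BddMeas.of_finite fun f : Mem F =>
        value M μs νs 0 M.x₁ - brValue M (σ.maxPolicy f) 0 M.x₁).comp (by fun_prop)
    rcases Nat.lt_or_ge 1 (Fintype.card (Mem F)) with hcard | hcard
    · have h1 : ∀ f : Mem F, value M μs νs 0 M.x₁ - brValue M (σ.maxPolicy f) 0 M.x₁ ≤ 1 :=
        fun f => by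
          have h2 := (R.brVal_mem_Icc (comp_mem_stepClass fs 0) (comp_mem_stepClass fs 0) M.x₁).2
          have h3 : value M μs νs 0 M.x₁ ≤ 1 := hV ▸ h2
          linarith [brValue_nonneg M (σ.maxPolicy f) 0 M.x₁]
      have h2 := integral_mono (hreg.integrable (processLaw F σ (1 / 10) l T))
        (integrable_const (T : ℝ)) fun ω =>
        (Finset.sum_le_sum fun t _ => h1 (ω t).1).trans (by simp)
      simp only [integral_const, probReal_univ, one_smul] at h2
      refine h2.trans ?_
      -- The regret is at most T, and T ≤ 2 T L = 2 l² D ≤ (2/25) l D.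
      have hL2 : 1 / 2 ≤ L := by
        have : Real.log 2 ≤ L := Real.log_le_log (by norm_num) (by exact_mod_cast hcard)
        linarith [Real.log_two_gt_d9]
      have hl0 : 0 ≤ l := Real.sqrt_nonneg _
      nlinarith [mul_nonneg hl0 hD.le, Nat.cast_nonneg (α := ℝ) T]
    -- In a one-element class both comparators and the sampled function coincide, so the regret
    -- vanishes, as it must because the right-hand side is 0.
    · have hsub : Subsingleton (Mem F) := Fintype.card_le_one_iff_subsingleton.1 hcard
      have h1 : ∀ f : Mem F, value M μs νs 0 M.x₁ - brValue M (σ.maxPolicy f) 0 M.x₁ = 0 :=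
        fun f => by
          obtain ⟨g, hg, -⟩ := exists_mem_brValue R f (hbr f)
          rw [← hV, ← hg, Subsingleton.elim g f, Subsingleton.elim fs f, sub_self]
      simp only [h1, Finset.sum_const_zero, integral_zero]
      have hl0 : 0 ≤ l := Real.sqrt_nonneg _
      positivity
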